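/- Let $v:\mathbb R\to\mathbb R$ be a smooth, $1$-periodic, non-constant function. For $d>0$ and $p=(\gamma,\mu)\in\mathbb R^2$ consider the cell problem of the curvature G-equation for the shear flow $V(x)=(v(x_2),0)$, $$-\frac{d\gamma^2 w''}{\gamma^2+(\mu+w')^2}+\sqrt{\gamma^2+(\mu+w')^2}+\gamma v(y)=H\quad\text{in }\mathbb R,\qquad(\ast)$$ where for $\gamma=0$ the first term is understood to be $0$. For every $d>0$ and $p$ there is exactly one number $H=\overline H_d(p)$ for which $(\ast)$ has a $1$-periodic solution $w\in C^2(\mathbb R)$, and for $H=\overline H_d(p)$ there is exactly one such solution with $w(0)=0$; call it $w=w_d$. Moreover, for every $p$ there is exactly one number $H=\overline H_0(p)$ for which the inviscid equation $$\sqrt{\gamma^2+(\mu+w_0')^2}+\gamma v(y)=H\quad\text{in }\mathbb R$$ has a continuous $1$-periodic viscosity solution $w_0$. The following hold. 1. $\overline H_d(0,\pm\mu)=|\mu|$ for all $d>0$ and $\mu\in\mathbb R$. 2. If $\gamma\neq0$, then $d\mapsto\overline H_d(p)$ is differentiable on $(0,\infty)$ with $\dfrac{\partial\overline H_d(p)}{\partial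 d}<0$ for every $d>0$; in particular $\overline H_d(p)$ is strictly decreasing in the Markstein number $d\in(0,\infty)$. 3. For every $p$, $\lim_{d\to0^+}\overline H_d(p)=\overline H_0(p)$. 4. For every $p=(\gamma,\mu)$, $\lim_{d\to+\infty}\overline H_d(p)=|p|+\gamma\int_0^1 v(y)\,dy$, where $|p|=\sqrt{\gamma^2+\mu^2}$, and $\lim_{d\to+\infty}w_d=0$ uniformly on $\mathbb R$. -/

import Mathlib

open Filter Topology
open scoped ContDiff

/-- `w` is a `C²`, `1`-periodic solution on `ℝ` of the cell problem
`-d γ² w'' / (γ² + (μ + w')²) + √(γ² + (μ + w')²) + γ v(y) = H`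
for the shear flow `V(x) = (v(x₂), 0)`, the slope `p = (γ, μ)` and the Markstein number `d`.
(For `γ = 0` the curvature term vanishes identically, also where `μ + w' = 0`.) -/
structure IsCellSolution (v : ℝ → ℝ) (d γ μ H : ℝ) (w : ℝ → ℝ) : Prop where
  contDiff : ContDiff ℝ 2 w
  periodic : Function.Periodic w 1
  equation : ∀ y : ℝ,
    -(d * γ ^ 2 * deriv (deriv w) y / (γ ^ 2 + (μ + deriv w y) ^ 2))
      + √(γ ^ 2 + (μ + deriv w y) ^ 2) + γ * v y = H

/-- The effective flame speed `H̄_d(γ, μ)`: the number for which the cell problem has a `C²`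
periodic solution. -/
noncomputable def effectiveSpeed (v : ℝ → ℝ) (d γ μ : ℝ) : ℝ :=
  Classical.epsilon fun H : ℝ => ∃ w : ℝ → ℝ, IsCellSolution v d γ μ H w

/-- The solution `w` of the cell problem that is normalized by `w(0) = 0`. -/
noncomputable def cellCorrector (v : ℝ → ℝ) (d γ μ : ℝ) : ℝ → ℝ :=
  Classical.epsilon fun w : ℝ → ℝ =>
    IsCellSolution v d γ μ (effectiveSpeed v d γ μ) w ∧ w 0 = 0

/-- `w` is a continuous viscosity subsolution on `ℝ` of `F(y, w') = 0`. -/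
def IsViscositySubsolution (F : ℝ → ℝ → ℝ) (w : ℝ → ℝ) : Prop :=
  Continuous w ∧ ∀ φ : ℝ → ℝ, ContDiff ℝ 1 φ → ∀ y : ℝ,
    IsLocalMax (fun x => w x - φ x) y → F y (deriv φ y) ≤ 0

/-- `w` is a continuous viscosity supersolution on `ℝ` of `F(y, w') = 0`. -/
def IsViscositySupersolution (F : ℝ → ℝ → ℝ) (w : ℝ → ℝ) : Prop :=
  Continuous w ∧ ∀ φ : ℝ → ℝ, ContDiff ℝ 1 φ → ∀ y : ℝ,
    IsLocalMin (fun x => w x - φ x) y → 0 ≤ F y (deriv φ y)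

/-- `w` is a continuous viscosity solution on `ℝ` of `F(y, w') = 0`. -/
def IsViscositySolution (F : ℝ → ℝ → ℝ) (w : ℝ → ℝ) : Prop :=
  IsViscositySubsolution F w ∧ IsViscositySupersolution F w

/-- `w` is a `1`-periodic viscosity solution of the inviscid cell problem
`√(γ² + (μ + w')²) + γ v(y) = H`. -/
def IsInviscidCellSolution (v : ℝ → ℝ) (γ μ H : ℝ) (w : ℝ → ℝ) : Prop :=
  Function.Periodic w 1 ∧
    IsViscositySolution (fun y q => √(γ ^ 2 + (μ + q) ^ 2) + γ * v y - H) w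

/-- The inviscid effective Hamiltonian `H̄_0(γ, μ)`: the number for which the inviscid cell
problem has a periodic viscosity solution. -/
noncomputable def inviscidEffectiveSpeed (v : ℝ → ℝ) (γ μ : ℝ) : ℝ :=
  Classical.epsilon fun H : ℝ => ∃ w : ℝ → ℝ, IsInviscidCellSolution v γ μ H w

/-! ### One-sided derivatives and differential inequalities -/

/-! For `γ ≠ 0` put `r = |γ|`, `f = γ v` and `u = μ + w'`. The cell problem becomes a first-order
equation for a periodic `u` of mean `μ`: `u' = (r² + u²)(E(u) + f - H) / (d r²)` with `E(t) = √(r² +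
t²)`. Its right-hand side strictly decreases in `H`. A periodic function of mean zero has a zero
where it does not increase and one where it does not decrease. Applied to differences of slopes,
this gives uniqueness and Lipschitz bounds for `H`; applied to `u - μ` it gives `|H - E(μ)| ≤ M`
when `|f| ≤ M`. Existence follows by shooting (`exists_isSlope`).

Monotonicity in `d` rests on the angle `A(u) = r arctan(u / r)`, for which `d A(u)' = E(u) + f - H`.
Let `ρ > 0` be periodic with `d r²/(r² + u²) ρ' + (u / E(u)) ρ = -c`, the adjoint linearized
equation. Testing the equations for `d` and `d'` with `ρ` cancels the first-order effect of the
change of `u`, whose mean is zero, and leaves `∂H/∂d = ∫ ρ' A(u) / ∫ ρ`. Since `A(u) = r arcsin(u /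
E(u))`, while `ρ'` is a negative multiple of `u / E(u) + c / ρ` and `∫ arcsin(-c / ρ) ρ' = 0`,
monotonicity of `arcsin` makes the numerator negative unless `u` is constant, which would make `v`
constant.

As `d → 0`, doubling of variables with penalty `(x - y)² / (2ε)` compares the viscous and inviscid
problems: at a touching point the curvature term costs at most `d / ε`, and `ε = √d` suffices. The
inviscid solution is built explicitly. As `d → ∞`, `u' = O(1/d)` forces `u → μ`, and integrating the
angle equation gives `H = ∫ E(u) + ∫ f`. The case `γ = 0` is elementary. -/

theorem nonneg_of_hasDerivWithinAt_Ioi {e : ℝ → ℝ} {c x : ℝ}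
    (h : HasDerivWithinAt e c (Set.Ioi x) x) (hm : ∀ᶠ z in 𝓝[>] x, e x ≤ e z) : 0 ≤ c := by
  rw [hasDerivWithinAt_iff_tendsto_slope' (by simp)] at h
  refine ge_of_tendsto h ?_
  filter_upwards [hm, self_mem_nhdsWithin] with z hz hxz
  rw [slope_def_field]
  exact div_nonneg (by linarith) (by linarith [Set.mem_Ioi.1 hxz])

theorem nonpos_of_hasDerivWithinAt_Iio {e : ℝ → ℝ} {c x : ℝ}
    (h : HasDerivWithinAt e c (Set.Iio x) x) (hm : ∀ᶠ z in 𝓝[<] x, e x ≤ e z) : c ≤ 0 := by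
  rw [hasDerivWithinAt_iff_tendsto_slope' (by simp)] at h
  refine le_of_tendsto h ?_
  filter_upwards [hm, self_mem_nhdsWithin] with z hz hxz
  rw [slope_def_field]
  exact div_nonpos_of_nonneg_of_nonpos (by linarith) (by linarith [Set.mem_Iio.1 hxz])

/-- A function vanishing at `a` whose derivative is positive at each of its zeros is positive
to the right of `a`. -/
theorem pos_of_deriv_pos_of_eq_zero {e e' : ℝ → ℝ} {a b : ℝ} (hab : a < b)
    (hd : ∀ x ∈ Set.Icc a b, HasDerivAt e (e' x) x)
    (h0 : ∀ x ∈ Set.Icc a b, e x = 0 → 0 < e' x) (ha : e a = 0) : 0 < e b := by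
  have hnn : ∀ ⦃x⦄, x ∈ Set.Icc a b → -e x ≤ 0 := by
    refine image_le_of_deriv_right_lt_deriv_boundary' (f := fun x => -e x) (f' := fun x => -e' x)
      (B := fun _ => 0) (B' := fun _ => 0) ?_ ?_ (by simp [ha]) continuousOn_const
      (fun x _ => hasDerivWithinAt_const _ _ _) ?_
    · exact fun x hx => (hd x hx).continuousAt.continuousWithinAt.neg
    · exact fun x hx => (hd x ⟨hx.1, hx.2.le⟩).hasDerivWithinAt.neg
    · intro x hx h
      have := h0 x ⟨hx.1, hx.2.le⟩ (by simpa using h)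
      simpa using this
  have hb : b ∈ Set.Icc a b := ⟨hab.le, le_rfl⟩
  -- A zero at `b` is excluded: `e ≥ 0` to its left would force `e' b ≤ 0`.
  rcases (neg_nonpos.1 (hnn hb)).lt_or_eq with h | h
  · exact h
  · refine absurd (h0 b hb h.symm) (not_lt.2 ?_)
    refine nonpos_of_hasDerivWithinAt_Iio (hd b hb).hasDerivWithinAt ?_
    filter_upwards [Ioo_mem_nhdsLT hab] with z hz
    rw [← h]
    exact neg_nonpos.1 (hnn ⟨hz.1.le, hz.2.le⟩)

/-- Grönwall's inequality in a convenient form. -/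
theorem abs_le_of_abs_deriv_le {e e' : ℝ → ℝ} {a b K δ ε : ℝ} (hK : 1 ≤ K) (hε : 0 ≤ ε)
    (hd : ∀ x ∈ Set.Icc a b, HasDerivAt e (e' x) x) (ha : |e a| ≤ δ)
    (hb : ∀ x ∈ Set.Icc a b, |e' x| ≤ K * |e x| + ε) :
    ∀ x ∈ Set.Icc a b, |e x| ≤ (δ + ε) * Real.exp (K * (b - a)) := by
  intro x hx
  have hδ : 0 ≤ δ := (abs_nonneg _).trans ha
  have h := norm_le_gronwallBound_of_norm_deriv_right_le (f := e) (f' := e') (δ := δ) (K := K)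
    (ε := ε) (a := a) (b := b) (fun x hx => (hd x hx).continuousAt.continuousWithinAt)
    (fun x hx => (hd x ⟨hx.1, hx.2.le⟩).hasDerivWithinAt) ha
    (fun x hx => hb x ⟨hx.1, hx.2.le⟩) x hx
  rw [gronwallBound_of_K_ne_0 (by positivity), Real.norm_eq_abs] at h
  refine h.trans ?_
  have h1 : Real.exp (K * (x - a)) ≤ Real.exp (K * (b - a)) := by
    gcongr; exact hx.2
  -- The assumption `1 ≤ K` serves to absorb the factor `1 / K` of the Grönwall bound; callers
  -- therefore pass `K + 1`.
  have h2 : ε / K ≤ ε := div_le_self hε hK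
  have h3 : 0 ≤ ε / K := by positivity
  have h4 : 0 < Real.exp (K * (x - a)) := Real.exp_pos _
  nlinarith [mul_le_mul_of_nonneg_left h1 hδ, mul_le_mul_of_nonneg_left h1 h3,
    mul_le_mul_of_nonneg_right h2 (h4.le.trans h1)]

theorem abs_integral_le_of_abs_le {g : ℝ → ℝ} {D : ℝ} (hg : ∀ y ∈ Set.Icc (0 : ℝ) 1, |g y| ≤ D) :
    |∫ y in (0 : ℝ)..1, g y| ≤ D := by
  have := intervalIntegral.norm_integral_le_of_norm_le_const (a := 0) (b := 1) (f := g) (C := D)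
    (fun y hy => hg y (by
      rw [Set.uIoc_of_le zero_le_one] at hy; exact ⟨hy.1.le, hy.2⟩))
  simpa using this

/-- The initial value problem for a bounded, globally Lipschitz, scalar field is solvable. -/
theorem exists_hasDerivAt_of_lipschitz_of_bounded {F : ℝ → ℝ → ℝ} {K C : ℝ} (hK : 0 ≤ K)
    (hC : 0 ≤ C) (hlip : ∀ y s t, |F y s - F y t| ≤ K * |s - t|) (hcont : ∀ t, Continuous (F · t))
    (hbd : ∀ y t, |F y t| ≤ C) (a : ℝ) :
    ∃ u : ℝ → ℝ, u 0 = a ∧ ∀ y ∈ Set.Icc (0 : ℝ) 1, HasDerivAt u (F y (u y)) y := by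
  lift K to NNReal using hK
  lift C to NNReal using hC
  -- Solving on `[-1, 2]` makes `[0, 1]` interior, so the derivatives are two-sided also at `0` and
  -- `1`; the radius `2 C` suffices for times up to distance `2` from `0`.
  have hpl : IsPicardLindelof F (tmin := -1) (tmax := 2) ⟨0, by norm_num, by norm_num⟩ a
      (C * 2) 0 C K := by
    refine ⟨fun y _ => LipschitzWith.lipschitzOnWith ?_, fun t _ => (hcont t).continuousOn,
      fun y _ t _ => hbd y t, ?_⟩
    · exact LipschitzWith.of_dist_le_mul fun s t => by simpa [Real.dist_eq] using hlip y s t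
    · norm_num
  obtain ⟨u, hu0, hu⟩ := hpl.exists_eq_forall_mem_Icc_hasDerivWithinAt₀
  refine ⟨u, hu0, fun y hy => (hu y ⟨by linarith [hy.1], by linarith [hy.2]⟩).hasDerivAt ?_⟩
  exact Icc_mem_nhds (by linarith [hy.1]) (by linarith [hy.2])

/-! ### Periodic functions -/

theorem Function.Periodic.exists_isMaxOn {u : ℝ → ℝ} (hu : Function.Periodic u 1)
    (hc : Continuous u) : ∃ y, ∀ x, u x ≤ u y := by
  obtain ⟨y, -, hy⟩ := (isCompact_Icc (a := (0 : ℝ)) (b := 1)).exists_isMaxOn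
    (Set.nonempty_Icc.2 zero_le_one) hc.continuousOn
  refine ⟨y, fun x => ?_⟩
  obtain ⟨z, hz, hxz⟩ := hu.exists_mem_Ico₀ one_pos x
  rw [hxz]
  exact hy ⟨hz.1, hz.2.le⟩

theorem Function.Periodic.exists_isMinOn {u : ℝ → ℝ} (hu : Function.Periodic u 1)
    (hc : Continuous u) : ∃ y, ∀ x, u y ≤ u x := by
  obtain ⟨y, hy⟩ := Function.Periodic.exists_isMaxOn (u := fun x => -u x)
    (fun x => by simp [hu x]) hc.neg
  exact ⟨y, fun x => neg_le_neg_iff.1 (hy x)⟩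

theorem Function.Periodic.exists_abs_le {u : ℝ → ℝ} (hu : Function.Periodic u 1)
    (hc : Continuous u) : ∃ M, 0 ≤ M ∧ ∀ x, |u x| ≤ M := by
  obtain ⟨y, hy⟩ := Function.Periodic.exists_isMaxOn (u := fun x => |u x|)
    (fun x => by simp [hu x]) hc.abs
  exact ⟨|u y|, abs_nonneg _, hy⟩

/-- The primitive of a periodic function with vanishing mean is periodic. -/
theorem Function.Periodic.periodic_primitive {q : ℝ → ℝ} (hq : Function.Periodic q 1)
    (hi : ∀ a b, IntervalIntegrable q MeasureTheory.volume a b)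
    (h0 : ∫ y in (0 : ℝ)..1, q y = 0) (a : ℝ) :
    Function.Periodic (fun y => ∫ x in a..y, q x) 1 := by
  intro y
  have := hq.intervalIntegral_add_eq y 0
  rw [zero_add, h0] at this
  simp only
  rw [← intervalIntegral.integral_add_adjacent_intervals (hi a y) (hi y (y + 1)), this, add_zero]

/-- A solution on `[0, 1]` of an ordinary differential equation with periodic right-hand side
that takes the same value at the end points extends to a periodic solution. -/
theorem exists_periodic_extension {F : ℝ → ℝ → ℝ} (hF : Continuous fun z : ℝ × ℝ => F z.1 z.2)
    (hper : ∀ y t, F (y + 1) t = F y t) {φ : ℝ → ℝ}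
    (hφ : ∀ y ∈ Set.Icc (0 : ℝ) 1, HasDerivAt φ (F y (φ y)) y) (h01 : φ 0 = φ 1) :
    ∃ u : ℝ → ℝ, Function.Periodic u 1 ∧ (∀ y, HasDerivAt u (F y (u y)) y) ∧
      ∀ y ∈ Set.Icc (0 : ℝ) 1, u y = φ y := by
  have hφc : ContinuousOn φ (Set.Icc 0 1) := fun y hy => (hφ y hy).continuousAt.continuousWithinAt
  have hfr : Continuous (fun y => φ (Int.fract y)) := ContinuousOn.comp_fract'' hφc h01
  -- The extension is the primitive of this continuous function, so differentiability at the
  -- integers needs no gluing argument.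
  set q : ℝ → ℝ := fun y => F y (φ (Int.fract y)) with hq
  have hqc : Continuous q := hF.comp (continuous_id.prodMk hfr)
  have hqp : Function.Periodic q 1 := fun y => by simp [hq, hper]
  have hfe : ∀ y ∈ Set.Icc (0 : ℝ) 1, φ (Int.fract y) = φ y := by
    intro y hy
    rcases hy.2.lt_or_eq with h | h
    · rw [Int.fract_eq_self.2 ⟨hy.1, h⟩]
    · rw [h, Int.fract_one, h01]
  have hint : ∀ y ∈ Set.Icc (0 : ℝ) 1, ∫ x in (0 : ℝ)..y, q x = φ y - φ 0 := by
    intro y hy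
    refine intervalIntegral.integral_eq_sub_of_hasDerivAt (fun x hx => ?_)
      (hqc.intervalIntegrable _ _)
    rw [Set.uIcc_of_le hy.1] at hx
    have hx' : x ∈ Set.Icc (0 : ℝ) 1 := ⟨hx.1, hx.2.trans hy.2⟩
    simpa [hq, hfe x hx'] using hφ x hx'
  have hper' : Function.Periodic (fun y => ∫ x in (0 : ℝ)..y, q x) 1 :=
    hqp.periodic_primitive (fun a b => hqc.intervalIntegrable _ _)
      (by rw [hint 1 ⟨zero_le_one, le_rfl⟩, h01, sub_self]) 0
  have hup : Function.Periodic (fun y => φ 0 + ∫ x in (0 : ℝ)..y, q x) 1 := fun y => by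
    simpa using hper' y
  have hue : ∀ y ∈ Set.Icc (0 : ℝ) 1, φ 0 + ∫ x in (0 : ℝ)..y, q x = φ y := fun y hy => by
    rw [hint y hy]; ring
  refine ⟨_, hup, fun y => ?_, hue⟩
  have hy : φ 0 + ∫ x in (0 : ℝ)..y, q x = φ (Int.fract y) := by
    rw [← hue _ ⟨Int.fract_nonneg y, (Int.fract_lt_one y).le⟩]
    have := hup.sub_int_mul_eq (x := y) ⌊y⌋
    rw [mul_one] at this
    exact this.symm
  simp only [hy]
  exact (hqc.integral_hasStrictDerivAt 0 y).hasDerivAt.const_add _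

/-! ### The eikonal function `t ↦ √(r² + t²)` -/

/-- The length of the vector `(r, t)`. -/
noncomputable def eikonal (r t : ℝ) : ℝ := √(r ^ 2 + t ^ 2)

theorem eikonal_sq (r t : ℝ) : eikonal r t ^ 2 = r ^ 2 + t ^ 2 :=
  Real.sq_sqrt (by positivity)

theorem eikonal_nonneg (r t : ℝ) : 0 ≤ eikonal r t := Real.sqrt_nonneg _

theorem abs_le_eikonal (r t : ℝ) : |t| ≤ eikonal r t :=
  Real.abs_le_sqrt (by nlinarith [sq_nonneg r])

theorem le_eikonal (r t : ℝ) : r ≤ eikonal r t :=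
  Real.le_sqrt_of_sq_le (by nlinarith [sq_nonneg t])

theorem eikonal_pos {r : ℝ} (hr : 0 < r) (t : ℝ) : 0 < eikonal r t := hr.trans_le (le_eikonal r t)

theorem eikonal_le_eikonal {r s t : ℝ} (h : |s| ≤ |t|) : eikonal r s ≤ eikonal r t :=
  Real.sqrt_le_sqrt (by linarith [sq_le_sq.2 h])

theorem continuous_eikonal (r : ℝ) : Continuous (eikonal r) := by
  unfold eikonal; fun_prop

theorem abs_eikonal_sub_le (r s t : ℝ) : |eikonal r s - eikonal r t| ≤ |s - t| := by
  have hs := eikonal_sq r s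
  have ht := eikonal_sq r t
  have h1 := abs_le.1 (abs_le_eikonal r s)
  have h2 := abs_le.1 (abs_le_eikonal r t)
  have hr := abs_nonneg (s - t)
  have hs0 := eikonal_nonneg r s
  have ht0 := eikonal_nonneg r t
  rcases (add_nonneg hs0 ht0).eq_or_lt with h | h
  · have e1 : eikonal r s = 0 := by linarith
    have e2 : eikonal r t = 0 := by linarith
    simp [e1, e2]
  · refine le_of_mul_le_mul_right ?_ h
    have : |eikonal r s - eikonal r t| * (eikonal r s + eikonal r t) = |s - t| * |s + t| := by
      rw [← abs_of_pos h, ← abs_mul, ← abs_mul]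
      congr 1; nlinarith
    rw [this]
    refine mul_le_mul_of_nonneg_left (abs_le.2 ⟨?_, ?_⟩) hr <;> linarith

/-- With `a = E(s)` and `b = E(t)` the Taylor remainder is `(a b - r² - s t) / b`, the
Cauchy–Schwarz defect of `(r, s)` and `(r, t)` over `b`. It is controlled through `(a b)² - (r² + s
t)² = r² (s - t)²`. -/
theorem abs_eikonal_sub_sub_le {r : ℝ} (hr : 0 < r) (s t : ℝ) :
    |eikonal r s - eikonal r t - t / eikonal r t * (s - t)| ≤ (s - t) ^ 2 / r := by
  have hE := eikonal_pos hr t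
  have hE1 := eikonal_pos hr s
  have hs := eikonal_sq r s
  have ht := eikonal_sq r t
  set a := eikonal r s
  set b := eikonal r t
  have hab : r ^ 2 + |s * t| ≤ a * b := by
    refine abs_le_of_sq_le_sq' ?_ (by positivity) |>.2
    rw [mul_pow, hs, ht]
    nlinarith [sq_nonneg (|s| - |t|), sq_abs s, sq_abs t, abs_mul s t, sq_nonneg r,
      mul_nonneg (sq_nonneg r) (sq_nonneg (|s| - |t|)), sq_abs (s * t)]
  have hst := neg_abs_le (s * t)
  have hst' := le_abs_self (s * t)
  have key : (a * b - r ^ 2 - s * t) * (a * b + r ^ 2 + s * t) = r ^ 2 * (s - t) ^ 2 := by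
    have : (a * b) ^ 2 = (r ^ 2 + s ^ 2) * (r ^ 2 + t ^ 2) := by rw [mul_pow, hs, ht]
    nlinarith
  have h0 : 0 ≤ a * b - r ^ 2 - s * t := by linarith
  have h1 : a * b - r ^ 2 - s * t ≤ (s - t) ^ 2 := by
    have h2 : r ^ 2 ≤ a * b + r ^ 2 + s * t := by nlinarith [sq_nonneg r]
    have := mul_le_mul_of_nonneg_left h2 h0
    rw [key, mul_comm] at this
    exact le_of_mul_le_mul_left this (by positivity)
  have e : a - b - t / b * (s - t) = (a * b - r ^ 2 - s * t) / b := by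
    field_simp
    nlinarith
  rw [e, abs_of_nonneg (by positivity)]
  exact div_le_div₀ (sq_nonneg _) h1 hr (le_eikonal r t)

/-! ### The primitive of the curvature coefficient -/

/-- The primitive `r arctan (t / r)` of `r² / (r² + t²)`. -/
noncomputable def curvAngle (r t : ℝ) : ℝ := r * Real.arctan (t / r)

theorem hasDerivAt_curvAngle {r : ℝ} (hr : 0 < r) (t : ℝ) :
    HasDerivAt (curvAngle r) (r ^ 2 / (r ^ 2 + t ^ 2)) t := by
  have h := (((hasDerivAt_id t).div_const r).arctan).const_mul r
  refine h.congr_deriv ?_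
  simp only [id]
  field_simp

theorem continuous_curvAngle (r : ℝ) : Continuous (curvAngle r) := by
  unfold curvAngle; fun_prop

theorem abs_curvature_sub_le {r : ℝ} (hr : 0 < r) (s t : ℝ) :
    |r ^ 2 / (r ^ 2 + s ^ 2) - r ^ 2 / (r ^ 2 + t ^ 2)| ≤ |s - t| / r := by
  have e : r ^ 2 / (r ^ 2 + s ^ 2) - r ^ 2 / (r ^ 2 + t ^ 2)
      = (t - s) * (r ^ 2 * (s + t) / ((r ^ 2 + s ^ 2) * (r ^ 2 + t ^ 2))) := by
    field_simp; ring
  rw [e, abs_mul, abs_sub_comm t s, div_eq_mul_one_div |s - t|]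
  refine mul_le_mul_of_nonneg_left ?_ (abs_nonneg _)
  rw [abs_div, div_le_div_iff₀ (by positivity) hr, abs_mul, abs_of_nonneg (sq_nonneg r),
    abs_of_nonneg (by positivity : (0 : ℝ) ≤ (r ^ 2 + s ^ 2) * (r ^ 2 + t ^ 2))]
  have h1 : |s + t| ≤ |s| + |t| := abs_add_le s t
  have hs := sq_abs s
  have ht := sq_abs t
  have a1 : 2 * r * |s| ≤ r ^ 2 + s ^ 2 := by nlinarith [sq_nonneg (r - |s|)]
  have a2 : 2 * r * |t| ≤ r ^ 2 + t ^ 2 := by nlinarith [sq_nonneg (r - |t|)]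
  have a3 : r ^ 2 * (2 * r * |s|) ≤ (r ^ 2 + t ^ 2) * (r ^ 2 + s ^ 2) := by
    apply mul_le_mul _ a1 (by positivity) (by positivity); nlinarith
  have a4 : r ^ 2 * (2 * r * |t|) ≤ (r ^ 2 + s ^ 2) * (r ^ 2 + t ^ 2) := by
    apply mul_le_mul _ a2 (by positivity) (by positivity); nlinarith
  have a5 : r ^ 2 * |s + t| * r ≤ r ^ 2 * (|s| + |t|) * r := by gcongr
  nlinarith

/-- Mean value inequality for `curvAngle` minus its linear part at `t`, whose derivative is small
because the curvature coefficient is `1 / r`-Lipschitz. -/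
theorem abs_curvAngle_sub_sub_le {r : ℝ} (hr : 0 < r) (s t : ℝ) :
    |curvAngle r s - curvAngle r t - r ^ 2 / (r ^ 2 + t ^ 2) * (s - t)| ≤ (s - t) ^ 2 / r := by
  have hd : ∀ x ∈ Set.uIcc t s, HasDerivWithinAt
      (fun x => curvAngle r x - r ^ 2 / (r ^ 2 + t ^ 2) * x)
      (r ^ 2 / (r ^ 2 + x ^ 2) - r ^ 2 / (r ^ 2 + t ^ 2)) (Set.uIcc t s) x := fun x _ => by
    have h := (hasDerivAt_curvAngle hr x).sub
      ((hasDerivAt_id x).const_mul (r ^ 2 / (r ^ 2 + t ^ 2)))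
    rw [mul_one] at h
    exact h.hasDerivWithinAt
  have := (convex_uIcc t s).norm_image_sub_le_of_norm_hasDerivWithin_le (C := |s - t| / r) hd
    (fun x hx => ?_) Set.left_mem_uIcc Set.right_mem_uIcc
  · rw [Real.norm_eq_abs, Real.norm_eq_abs] at this
    calc _ = _ := by congr 1; ring
      _ ≤ _ := this
      _ = (s - t) ^ 2 / r := by rw [← sq_abs (s - t)]; ring
  · refine (abs_curvature_sub_le hr x t).trans ?_
    gcongr 1
    exact Set.abs_sub_left_of_mem_uIcc hx

/-! ### Zeros of periodic functions -/

/-- Rolle's theorem for the primitive. -/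
theorem exists_eq_zero_of_integral_eq_zero {e : ℝ → ℝ} (hc : Continuous e)
    (h : ∫ y in (0 : ℝ)..1, e y = 0) : ∃ y, e y = 0 := by
  obtain ⟨y, -, hy⟩ := exists_hasDerivAt_eq_zero (f := fun y => ∫ x in (0 : ℝ)..y, e x) (f' := e)
    zero_lt_one
    (fun y _ => (hc.integral_hasStrictDerivAt 0 y).hasDerivAt.continuousAt.continuousWithinAt)
    (by simp [h]) (fun y _ => (hc.integral_hasStrictDerivAt 0 y).hasDerivAt)
  exact ⟨y, hy⟩

/-- A periodic function with a zero has a zero at which it does not increase. -/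
theorem Function.Periodic.exists_eq_zero_deriv_nonpos {e e' : ℝ → ℝ} (hp : Function.Periodic e 1)
    (hd : ∀ y, HasDerivAt e (e' y) y) (h0 : ∃ y, e y = 0) : ∃ y, e y = 0 ∧ e' y ≤ 0 := by
  obtain ⟨z, hz⟩ := h0
  by_contra! hcon
  -- If every zero were a strict upcrossing, `e` would be positive at `z + 1`, where periodicity
  -- makes it vanish.
  have := pos_of_deriv_pos_of_eq_zero (a := z) (b := z + 1) (by linarith) (fun x _ => hd x)
    (fun x _ => hcon x) hz
  rw [hp z, hz] at this
  exact lt_irrefl _ this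

theorem Function.Periodic.exists_eq_zero_deriv_nonneg {e e' : ℝ → ℝ} (hp : Function.Periodic e 1)
    (hd : ∀ y, HasDerivAt e (e' y) y) (h0 : ∃ y, e y = 0) : ∃ y, e y = 0 ∧ 0 ≤ e' y := by
  obtain ⟨y, hy, hyd⟩ := Function.Periodic.exists_eq_zero_deriv_nonpos (e := fun y => -e y)
    (fun y => by simp [hp y]) (fun y => (hd y).neg) (by simpa using h0)
  exact ⟨y, by simpa using hy, by simpa using hyd⟩

/-! ### The slope equation -/

/-- The right-hand side of the equation `u' = (r² + u²) (√(r² + u²) + f - H) / (d r²)` satisfied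
by the slope `u = μ + w'`; the argument `s` stands for the value of `f`. -/
noncomputable def slopeField (d r H s t : ℝ) : ℝ :=
  (r ^ 2 + t ^ 2) * (eikonal r t + s - H) / (d * r ^ 2)

/-- `u` is a periodic solution of the slope equation. -/
structure IsSlope (f : ℝ → ℝ) (d r H : ℝ) (u : ℝ → ℝ) : Prop where
  periodic : Function.Periodic u 1
  hasDerivAt : ∀ y, HasDerivAt u (slopeField d r H (f y) (u y)) y

theorem IsSlope.continuous {f : ℝ → ℝ} {d r H : ℝ} {u : ℝ → ℝ} (h : IsSlope f d r H u) :
    Continuous u :=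
  continuous_iff_continuousAt.2 fun y => (h.hasDerivAt y).continuousAt

/-- Strict monotonicity in the speed: it decides the sign at crossings both in the uniqueness proof
and in the shooting argument. -/
theorem slopeField_sub (d r H H' s t : ℝ) :
    slopeField d r H s t - slopeField d r H' s t = (r ^ 2 + t ^ 2) / (d * r ^ 2) * (H' - H) := by
  unfold slopeField; ring

theorem slopeField_le_zero_iff {d r : ℝ} (hd : 0 < d) (hr : 0 < r) {H s t : ℝ} :
    slopeField d r H s t ≤ 0 ↔ eikonal r t + s ≤ H := by
  have h1 : 0 < (r ^ 2 + t ^ 2) / (d * r ^ 2) := by positivity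
  have : slopeField d r H s t = (r ^ 2 + t ^ 2) / (d * r ^ 2) * (eikonal r t + s - H) := by
    unfold slopeField; ring
  rw [this, ← sub_nonpos (b := H)]
  exact ⟨fun h => by by_contra! hc; exact absurd h (not_le.2 (mul_pos h1 hc)),
    fun h => mul_nonpos_of_nonneg_of_nonpos h1.le h⟩

theorem zero_le_slopeField_iff {d r : ℝ} (hd : 0 < d) (hr : 0 < r) {H s t : ℝ} :
    0 ≤ slopeField d r H s t ↔ H ≤ eikonal r t + s := by
  have h1 : 0 < (r ^ 2 + t ^ 2) / (d * r ^ 2) := by positivity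
  have : slopeField d r H s t = (r ^ 2 + t ^ 2) / (d * r ^ 2) * (eikonal r t + s - H) := by
    unfold slopeField; ring
  rw [this, ← sub_nonneg (b := H)]
  exact mul_nonneg_iff_of_pos_left h1

theorem abs_slopeField_le {d r : ℝ} (hd : 0 < d) (hr : 0 < r) {B S H s t : ℝ} (ht : |t| ≤ B)
    (hs : |s - H| ≤ S) :
    |slopeField d r H s t| ≤ (r ^ 2 + B ^ 2) * (eikonal r B + S) / (d * r ^ 2) := by
  have hB : |t| ≤ |B| := ht.trans (le_abs_self B)
  have hE := eikonal_le_eikonal (r := r) hB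
  have h0 := eikonal_nonneg r t
  unfold slopeField
  rw [abs_div, abs_mul, abs_of_nonneg (by positivity : (0 : ℝ) ≤ r ^ 2 + t ^ 2),
    abs_of_pos (by positivity : (0 : ℝ) < d * r ^ 2)]
  refine div_le_div_of_nonneg_right (mul_le_mul ?_ ?_ (abs_nonneg _) (by positivity))
    (by positivity)
  · linarith [sq_le_sq.2 hB]
  · rw [add_sub_assoc]
    refine (abs_add_le _ _).trans ?_
    rw [abs_of_nonneg h0]
    linarith

/-- A Lipschitz constant of the slope field on `[-B, B]`. -/
noncomputable def slopeLip (d r B S : ℝ) : ℝ :=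
  (2 * B * (eikonal r B + S) + (r ^ 2 + B ^ 2)) / (d * r ^ 2)

theorem abs_slopeField_sub_le {d r : ℝ} (hd : 0 < d) (hr : 0 < r) {B S H s t t' : ℝ}
    (ht : |t| ≤ B) (ht' : |t'| ≤ B) (hs : |s - H| ≤ S) :
    |slopeField d r H s t - slopeField d r H s t'| ≤ slopeLip d r B S * |t - t'| := by
  have hB : |t| ≤ |B| := ht.trans (le_abs_self B)
  have hB' : |t'| ≤ |B| := ht'.trans (le_abs_self B)
  have hE := eikonal_le_eikonal (r := r) hB
  have h0 := eikonal_nonneg r t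
  have e : slopeField d r H s t - slopeField d r H s t'
      = ((t + t') * (t - t') * (eikonal r t + (s - H))
        + (r ^ 2 + t' ^ 2) * (eikonal r t - eikonal r t')) / (d * r ^ 2) := by
    unfold slopeField; ring
  rw [e, slopeLip, abs_div, abs_of_pos (by positivity : (0 : ℝ) < d * r ^ 2), div_mul_eq_mul_div]
  refine div_le_div_of_nonneg_right ((abs_add_le _ _).trans ?_) (by positivity)
  rw [abs_mul, abs_mul, abs_mul, abs_of_nonneg (by positivity : (0 : ℝ) ≤ r ^ 2 + t' ^ 2),
    add_mul (2 * B * (eikonal r B + S))]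
  have hΔ := abs_nonneg (t - t')
  have h1 : |t + t'| ≤ 2 * B := (abs_add_le _ _).trans (by linarith)
  have h2 : |eikonal r t + (s - H)| ≤ eikonal r B + S :=
    (abs_add_le _ _).trans (by rw [abs_of_nonneg h0]; linarith)
  have h3 : r ^ 2 + t' ^ 2 ≤ r ^ 2 + B ^ 2 := by linarith [sq_le_sq.2 hB']
  have h4 := abs_eikonal_sub_le r t t'
  refine add_le_add ?_ (mul_le_mul h3 h4 (abs_nonneg _) (by positivity))
  calc |t + t'| * |t - t'| * |eikonal r t + (s - H)|
      ≤ (2 * B) * |t - t'| * (eikonal r B + S) := by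
        refine mul_le_mul (mul_le_mul_of_nonneg_right h1 hΔ) h2 (abs_nonneg _) ?_
        exact mul_nonneg ((abs_nonneg _).trans h1) hΔ
    _ = _ := by ring

/-- A priori bound for the slope equation with a modified nonlinearity: the effective speed. -/
theorem abs_speed_sub_eikonal_le {f u κ : ℝ → ℝ} {d r H M μ : ℝ} (hd : 0 < d) (hr : 0 < r)
    (hM : ∀ y, |f y| ≤ M) (hp : Function.Periodic u 1)
    (hu : ∀ y, HasDerivAt u (slopeField d r H (f y) (κ (u y))) y)
    (hμ : ∫ y in (0 : ℝ)..1, u y = μ) (hκ : κ μ = μ) : |H - eikonal r μ| ≤ M := by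
  have hc : Continuous u := continuous_iff_continuousAt.2 fun y => (hu y).continuousAt
  -- At a zero of `u - μ` the field is evaluated at the slope `κ μ = μ`, so its sign compares `H`
  -- with `eikonal r μ + f`. A zero with each sign of the derivative gives the two bounds.
  have hz : ∃ y, u y - μ = 0 := exists_eq_zero_of_integral_eq_zero (hc.sub continuous_const) (by
    rw [intervalIntegral.integral_sub (hc.intervalIntegrable _ _) (by simp), hμ]; simp)
  have hp' : Function.Periodic (fun y => u y - μ) 1 := fun y => by simp [hp y]
  obtain ⟨y, hy, hy'⟩ := hp'.exists_eq_zero_deriv_nonpos (fun y => (hu y).sub_const μ) hz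
  obtain ⟨x, hx, hx'⟩ := hp'.exists_eq_zero_deriv_nonneg (fun y => (hu y).sub_const μ) hz
  rw [slopeField_le_zero_iff hd hr, sub_eq_zero.1 hy, hκ] at hy'
  rw [zero_le_slopeField_iff hd hr, sub_eq_zero.1 hx, hκ] at hx'
  have h1 := abs_le.1 (hM y)
  have h2 := abs_le.1 (hM x)
  exact abs_le.2 ⟨by linarith, by linarith⟩

/-- A priori bound for the slope equation with a modified nonlinearity: the slope. -/
theorem eikonal_slope_le {f u κ : ℝ → ℝ} {d r H M μ : ℝ} (hd : 0 < d) (hr : 0 < r)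
    (hM : ∀ y, |f y| ≤ M) (hp : Function.Periodic u 1)
    (hu : ∀ y, HasDerivAt u (slopeField d r H (f y) (κ (u y))) y)
    (hμ : ∫ y in (0 : ℝ)..1, u y = μ) (hκ : κ μ = μ) (hmono : Monotone κ) (y : ℝ) :
    eikonal r (κ (u y)) ≤ eikonal r μ + 2 * M := by
  have hc : Continuous u := continuous_iff_continuousAt.2 fun y => (hu y).continuousAt
  have hH := abs_le.1 (abs_speed_sub_eikonal_le hd hr hM hp hu hμ hκ)
  obtain ⟨a, ha⟩ := hp.exists_isMaxOn hc
  obtain ⟨b, hb⟩ := hp.exists_isMinOn hc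
  -- At the extrema of `u` the field vanishes, whence `eikonal r (κ u) ≤ H - f` there. As `κ` is
  -- monotone, `|κ (u y)|` is at most its value at one of the two extrema.
  have ha' := (IsLocalMax.hasDerivAt_eq_zero (Eventually.of_forall ha) (hu a)).le
  have hb' := (IsLocalMin.hasDerivAt_eq_zero (Eventually.of_forall hb) (hu b)).le
  rw [slopeField_le_zero_iff hd hr] at ha' hb'
  have h1 := abs_le.1 (hM a)
  have h2 := abs_le.1 (hM b)
  rcases le_max_iff.1 (abs_le_max_abs_abs (hmono (hb y)) (hmono (ha y))) with h | h
  · linarith [eikonal_le_eikonal (r := r) h]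
  · linarith [eikonal_le_eikonal (r := r) h]

theorem IsSlope.abs_speed_sub_le {f u : ℝ → ℝ} {d r H M μ : ℝ} (h : IsSlope f d r H u) (hd : 0 < d)
    (hr : 0 < r) (hM : ∀ y, |f y| ≤ M) (hμ : ∫ y in (0 : ℝ)..1, u y = μ) :
    |H - eikonal r μ| ≤ M :=
  abs_speed_sub_eikonal_le (κ := id) hd hr hM h.periodic h.hasDerivAt hμ rfl

theorem IsSlope.abs_slope_le {f u : ℝ → ℝ} {d r H M μ : ℝ} (h : IsSlope f d r H u) (hd : 0 < d)
    (hr : 0 < r) (hM : ∀ y, |f y| ≤ M) (hμ : ∫ y in (0 : ℝ)..1, u y = μ) (y : ℝ) :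
    |u y| ≤ eikonal r μ + 2 * M :=
  (abs_le_eikonal r _).trans
    (eikonal_slope_le (κ := id) hd hr hM h.periodic h.hasDerivAt hμ rfl monotone_id y)

/-- Periodic solutions of the slope equation with equal means coincide, together with their
speeds. -/
theorem IsSlope.unique {f u u' : ℝ → ℝ} {d r H H' : ℝ} (h : IsSlope f d r H u)
    (h' : IsSlope f d r H' u') (hd : 0 < d) (hr : 0 < r) (hf : Continuous f)
    (hfp : Function.Periodic f 1)
    (hμ : ∫ y in (0 : ℝ)..1, u y = ∫ y in (0 : ℝ)..1, u' y) : H = H' ∧ u = u' := by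
  have hc := h.continuous
  have hc' := h'.continuous
  have hz : ∃ y, u y - u' y = 0 := exists_eq_zero_of_integral_eq_zero (hc.sub hc') (by
    rw [intervalIntegral.integral_sub (hc.intervalIntegrable _ _) (hc'.intervalIntegrable _ _), hμ,
      sub_self])
  have hp : Function.Periodic (fun y => u y - u' y) 1 := fun y => by
    simp [h.periodic y, h'.periodic y]
  have hder := fun y => (h.hasDerivAt y).sub (h'.hasDerivAt y)
  -- At a common value of `u` and `u'` the two fields differ by a positive multiple of `H' - H`;
  -- crossings with both signs of the derivative force equality.
  have hH : H = H' := by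
    obtain ⟨y, hy, hy'⟩ := hp.exists_eq_zero_deriv_nonpos hder hz
    obtain ⟨x, hx, hx'⟩ := hp.exists_eq_zero_deriv_nonneg hder hz
    rw [sub_eq_zero.1 hy, slopeField_sub] at hy'
    rw [sub_eq_zero.1 hx, slopeField_sub] at hx'
    have h1 : 0 < (r ^ 2 + u' y ^ 2) / (d * r ^ 2) := by positivity
    have h2 : 0 < (r ^ 2 + u' x ^ 2) / (d * r ^ 2) := by positivity
    have h3 := nonneg_of_mul_nonneg_right hx' h2
    have h4 : H' - H ≤ 0 := by
      by_contra! hcon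
      exact absurd hy' (not_le.2 (mul_pos h1 hcon))
    linarith
  refine ⟨hH, ?_⟩
  subst hH
  obtain ⟨M, hM0, hM⟩ := hfp.exists_abs_le hf
  obtain ⟨B, hB0, hB⟩ := h.periodic.exists_abs_le hc
  obtain ⟨B', hB0', hB'⟩ := h'.periodic.exists_abs_le hc'
  obtain ⟨z, hz⟩ := hz
  -- With equal speeds both slopes solve the same locally Lipschitz equation and agree at `z`.
  have hzero : ∀ y ∈ Set.Icc z (z + 1), u y - u' y = 0 := by
    refine eq_zero_of_abs_deriv_le_mul_abs_self_of_eq_zero_right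
      (K := slopeLip d r (max B B') (M + |H|)) (hc.sub hc').continuousOn
      (fun y _ => (hder y).hasDerivWithinAt) hz (fun y _ => ?_)
    exact abs_slopeField_sub_le hd hr ((hB y).trans (le_max_left _ _))
      ((hB' y).trans (le_max_right _ _)) ((abs_sub _ _).trans (by linarith [hM y]))
  funext y
  obtain ⟨x, hx, hxy⟩ := hp.exists_mem_Ico one_pos y z
  have := hzero x ⟨hx.1, hx.2.le⟩
  have hxy' : u y - u' y = u x - u' x := hxy
  linarith

/-! ### Existence for the slope equation by shooting -/

/-- The zero of a function that is strictly decreasing in its second argument depends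
continuously on the first argument. -/
theorem exists_continuous_zero {N : ℝ → ℝ → ℝ} {S : ℝ} (hS : 0 ≤ S)
    (hc₁ : ∀ h ∈ Set.Icc (-S) S, Continuous (N · h))
    (hc₂ : ∀ a, ContinuousOn (N a) (Set.Icc (-S) S))
    (hanti : ∀ a, StrictAntiOn (N a) (Set.Icc (-S) S))
    (hpos : ∀ a, 0 < N a (-S)) (hneg : ∀ a, N a S < 0) :
    ∃ h : ℝ → ℝ, Continuous h ∧ ∀ a, h a ∈ Set.Icc (-S) S ∧ N a (h a) = 0 := by
  have hex : ∀ a, ∃ h ∈ Set.Icc (-S) S, N a h = 0 := fun a =>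
    intermediate_value_Icc' (by linarith) (hc₂ a) ⟨(hneg a).le, (hpos a).le⟩
  choose h hmem hzero using hex
  -- For `c ≠ h a` the sign of `N a c` persists for `b` near `a`, and monotonicity of `N b` then
  -- keeps `h b` on the same side of `c`.
  refine ⟨h, continuous_iff_continuousAt.2 fun a => tendsto_order.2 ⟨fun c hc => ?_, fun c hc => ?_⟩,
    fun a => ⟨hmem a, hzero a⟩⟩
  · rcases lt_or_ge c (-S) with hcS | hcS
    · exact Eventually.of_forall fun b => hcS.trans_le (hmem b).1
    · have hcm : c ∈ Set.Icc (-S) S := ⟨hcS, hc.le.trans (hmem a).2⟩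
      have h1 : 0 < N a c := by rw [← hzero a]; exact hanti a hcm (hmem a) hc
      filter_upwards [(hc₁ c hcm).continuousAt.eventually (lt_mem_nhds h1)] with b hb
      by_contra! hcon
      have := (hanti b).antitoneOn (hmem b) hcm hcon
      rw [hzero b] at this
      exact absurd hb (not_lt.2 this)
  · rcases lt_or_ge S c with hcS | hcS
    · exact Eventually.of_forall fun b => (hmem b).2.trans_lt hcS
    · have hcm : c ∈ Set.Icc (-S) S := ⟨(hmem a).1.trans hc.le, hcS⟩
      have h1 : N a c < 0 := by rw [← hzero a]; exact hanti a (hmem a) hcm hc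
      filter_upwards [(hc₁ c hcm).continuousAt.eventually (gt_mem_nhds h1)] with b hb
      by_contra! hcon
      have := (hanti b).antitoneOn hcm (hmem b) hcon
      rw [hzero b] at this
      exact absurd hb (not_lt.2 this)

/-- Truncation of the real line to `[-B, B]`. -/
noncomputable def clip (B t : ℝ) : ℝ := max (-B) (min t B)

theorem abs_clip_le {B : ℝ} (hB : 0 ≤ B) (t : ℝ) : |clip B t| ≤ B :=
  abs_le.2 ⟨le_max_left _ _, max_le (by linarith) (min_le_right _ _)⟩

theorem clip_eq_self {B t : ℝ} (h : |t| ≤ B) : clip B t = t := by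
  rw [clip, min_eq_left (abs_le.1 h).2, max_eq_right (abs_le.1 h).1]

theorem abs_le_of_abs_clip_lt {B t : ℝ} (h : |clip B t| < B) : |t| ≤ B := by
  have h' := abs_lt.1 h
  unfold clip at h'
  rcases min_cases t B with h1 | h1 <;> rcases max_cases (-B) (min t B) with h2 | h2 <;>
    exact abs_le.2 ⟨by linarith, by linarith⟩

theorem abs_clip_sub_le (B s t : ℝ) : |clip B s - clip B t| ≤ |s - t| := by
  refine (abs_max_sub_max_le_max _ _ _ _).trans ?_
  rw [sub_self, abs_zero, max_eq_right (abs_nonneg _)]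
  refine (abs_min_sub_min_le_max _ _ _ _).trans ?_
  rw [sub_self, abs_zero, max_eq_left (abs_nonneg _)]

theorem clip_mono (B : ℝ) : Monotone (clip B) := fun _ _ h =>
  max_le_max le_rfl (min_le_min h le_rfl)

theorem continuous_clip (B : ℝ) : Continuous (clip B) := by
  unfold clip; fun_prop

theorem continuous_slopeField_clip {f : ℝ → ℝ} (hf : Continuous f) (d r H B : ℝ) :
    Continuous fun z : ℝ × ℝ => slopeField d r H (f z.1) (clip B z.2) := by
  have h1 : Continuous fun z : ℝ × ℝ => clip B z.2 := (continuous_clip B).comp continuous_snd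
  have h2 : Continuous fun z : ℝ × ℝ => eikonal r (clip B z.2) := (continuous_eikonal r).comp h1
  unfold slopeField
  fun_prop

/-- For a truncated slope field there is a family of trajectories on `[0, 1]` indexed by the
initial value `a` and the speed `h`, with Lipschitz dependence on both. -/
theorem exists_clipped_flow {f : ℝ → ℝ} {d r B M S : ℝ} (hd : 0 < d) (hr : 0 < r)
    (hf : Continuous f) (hM : ∀ y, |f y| ≤ M) (hB : 0 ≤ B) (hS : 0 ≤ S) :
    ∃ (φ : ℝ → ℝ → ℝ → ℝ) (C : ℝ), 0 ≤ C ∧ ∀ h ∈ Set.Icc (-S) S, ∀ a,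
      φ a h 0 = a ∧
      (∀ y ∈ Set.Icc (0 : ℝ) 1, HasDerivAt (φ a h) (slopeField d r h (f y) (clip B (φ a h y))) y) ∧
      (∀ y ∈ Set.Icc (0 : ℝ) 1, |φ a h y - a| ≤ C) ∧
      ∀ h' ∈ Set.Icc (-S) S, ∀ a', ∀ y ∈ Set.Icc (0 : ℝ) 1,
        |φ a h y - φ a' h' y| ≤ C * (|a - a'| + |h - h'|) := by
  have hM0 : 0 ≤ M := (abs_nonneg _).trans (hM 0)
  have hE := eikonal_nonneg r B
  set K := slopeLip d r B (M + S) with hK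
  have hK0 : 0 ≤ K := by rw [hK, slopeLip]; positivity
  set C₀ := (r ^ 2 + B ^ 2) * (eikonal r B + (M + S)) / (d * r ^ 2) with hC₀
  have hC₀0 : 0 ≤ C₀ := by positivity
  have hs : ∀ h ∈ Set.Icc (-S) S, ∀ y, |f y - h| ≤ M + S := fun h hh y =>
    (abs_sub _ _).trans (add_le_add (hM y) (abs_le.2 hh))
  have hbd : ∀ h ∈ Set.Icc (-S) S, ∀ y t, |slopeField d r h (f y) (clip B t)| ≤ C₀ :=
    fun h hh y t => abs_slopeField_le hd hr (abs_clip_le hB t) (hs h hh y)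
  have hlip : ∀ h ∈ Set.Icc (-S) S, ∀ y s t,
      |slopeField d r h (f y) (clip B s) - slopeField d r h (f y) (clip B t)| ≤ K * |s - t| :=
    fun h hh y s t => (abs_slopeField_sub_le hd hr (abs_clip_le hB s) (abs_clip_le hB t)
      (hs h hh y)).trans (mul_le_mul_of_nonneg_left (abs_clip_sub_le B s t) hK0)
  have hex : ∀ a h, ∃ u : ℝ → ℝ, h ∈ Set.Icc (-S) S → u 0 = a ∧
      ∀ y ∈ Set.Icc (0 : ℝ) 1, HasDerivAt u (slopeField d r h (f y) (clip B (u y))) y := by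
    intro a h
    by_cases hh : h ∈ Set.Icc (-S) S
    · obtain ⟨u, hu⟩ := exists_hasDerivAt_of_lipschitz_of_bounded
        (F := fun y t => slopeField d r h (f y) (clip B t)) hK0 hC₀0 (hlip h hh)
        (fun t => (continuous_slopeField_clip hf d r h B).comp (by fun_prop : Continuous
          fun y : ℝ => (y, t))) (hbd h hh) a
      exact ⟨u, fun _ => hu⟩
    · exact ⟨0, fun h => absurd h hh⟩
  choose φ hφ using hex
  set C₁ := (r ^ 2 + B ^ 2) / (d * r ^ 2) with hC₁
  have hC₁0 : 0 ≤ C₁ := by positivity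
  set C₂ := (1 + C₁) * Real.exp (K + 1) with hC₂
  have hC₂0 : 0 ≤ C₂ := by positivity
  refine ⟨φ, C₀ + C₂, by positivity, fun h hh a => ⟨(hφ a h hh).1, (hφ a h hh).2, ?_, ?_⟩⟩
  · intro y hy
    have := (convex_Icc (0 : ℝ) 1).norm_image_sub_le_of_norm_hasDerivWithin_le (C := C₀)
      (fun x hx => ((hφ a h hh).2 x hx).hasDerivWithinAt) (fun x hx => hbd h hh x _)
      (⟨le_rfl, zero_le_one⟩ : (0 : ℝ) ∈ Set.Icc (0 : ℝ) 1) hy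
    rw [(hφ a h hh).1, Real.norm_eq_abs, Real.norm_eq_abs, sub_zero, abs_of_nonneg hy.1] at this
    nlinarith [hy.1, hy.2]
  · intro h' hh' a' y hy
    have key := abs_le_of_abs_deriv_le (e := fun y => φ a h y - φ a' h' y) (a := 0) (b := 1)
      (K := K + 1) (δ := |a - a'|) (ε := C₁ * |h - h'|) (by linarith) (by positivity)
      (fun x hx => ((hφ a h hh).2 x hx).sub ((hφ a' h' hh').2 x hx))
      (by rw [(hφ a h hh).1, (hφ a' h' hh').1]) (fun x hx => ?_) y hy
    · refine key.trans ?_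
      rw [sub_zero, mul_one, hC₂]
      have h1 := abs_nonneg (a - a')
      have h2 := abs_nonneg (h - h')
      have h3 := Real.exp_pos (K + 1)
      nlinarith [mul_nonneg hC₀0 h1, mul_nonneg hC₀0 h2, mul_nonneg (mul_nonneg hC₁0 h1) h3.le,
        mul_nonneg h2 h3.le]
    · set s := φ a h x
      set t := φ a' h' x
      have e : slopeField d r h (f x) (clip B s) - slopeField d r h' (f x) (clip B t)
          = (slopeField d r h (f x) (clip B s) - slopeField d r h (f x) (clip B t))
            + (r ^ 2 + clip B t ^ 2) / (d * r ^ 2) * (h' - h) := by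
        rw [← slopeField_sub]; ring
      rw [e]
      refine (abs_add_le _ _).trans (add_le_add ?_ ?_)
      · refine (hlip h hh x s t).trans ?_
        nlinarith [abs_nonneg (s - t)]
      · rw [abs_mul, abs_sub_comm h' h, abs_of_nonneg (by positivity)]
        have h1 : clip B t ^ 2 ≤ B ^ 2 := sq_le_sq.2 ((abs_clip_le hB t).trans (le_abs_self B))
        refine mul_le_mul_of_nonneg_right ?_ (abs_nonneg _)
        exact div_le_div_of_nonneg_right (by linarith) (by positivity)

/-- Shooting for the truncated equation. For each initial value `a`, the closing defect `φ a h 1 -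
a` is strictly decreasing in `h` and changes sign on `[-S, S]`, so exactly one speed `h a` closes
the trajectory, and it depends continuously on `a`. Trajectories stay within `C` of their initial
value, so their mean differs from `a` by at most `C` and takes the value `μ`. The a priori bound,
valid for the truncated field too, then shows that the truncation is inactive. -/
theorem exists_isSlope {f : ℝ → ℝ} {d r : ℝ} (hd : 0 < d) (hr : 0 < r)
    (hf : Continuous f) (hfp : Function.Periodic f 1) (μ : ℝ) :
    ∃ H u, IsSlope f d r H u ∧ ∫ y in (0 : ℝ)..1, u y = μ := by
  obtain ⟨M, hM0, hM⟩ := hfp.exists_abs_le hf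
  have hEμ := eikonal_nonneg r μ
  -- One more than the a priori bound for the slope, so that the truncation level is never reached.
  set B := eikonal r μ + 2 * M + 1 with hBdef
  have hB : 0 ≤ B := by positivity
  have hEB := eikonal_nonneg r B
  -- Large enough for the truncated field to be positive everywhere at speed `-S` and negative
  -- everywhere at speed `S`.
  set S := eikonal r B + M + 1 with hSdef
  have hS : 0 ≤ S := by positivity
  obtain ⟨φ, C, hC, hφ⟩ := exists_clipped_flow hd hr hf hM hB hS
  have ho : (1 : ℝ) ∈ Set.Icc (0 : ℝ) 1 := ⟨zero_le_one, le_rfl⟩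
  have hSm : -S ∈ Set.Icc (-S) S := ⟨le_rfl, by linarith⟩
  have hSp : S ∈ Set.Icc (-S) S := ⟨by linarith, le_rfl⟩
  have hcontOn : ∀ h ∈ Set.Icc (-S) S, ∀ a, ContinuousOn (φ a h) (Set.Icc 0 1) :=
    fun h hh a y hy => ((hφ h hh a).2.1 y hy).continuousAt.continuousWithinAt
  -- By the mean value theorem the closing defect is a value of the field, hence inherits its sign
  -- at `h = ±S`.
  have hmv : ∀ h ∈ Set.Icc (-S) S, ∀ a, ∃ y, φ a h 1 - a =
      slopeField d r h (f y) (clip B (φ a h y)) := by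
    intro h hh a
    obtain ⟨y, -, hy⟩ := exists_hasDerivAt_eq_slope (φ a h)
      (fun y => slopeField d r h (f y) (clip B (φ a h y))) zero_lt_one (hcontOn h hh a)
      (fun y hy => (hφ h hh a).2.1 y ⟨hy.1.le, hy.2.le⟩)
    exact ⟨y, by rw [hy, (hφ h hh a).1]; ring⟩
  obtain ⟨h, hhc, hh⟩ := exists_continuous_zero (N := fun a h => φ a h 1 - a) hS
    (fun h hh => by
      refine Continuous.sub (continuous_iff_continuousAt.2 fun a => ?_) continuous_id
      refine tendsto_iff_dist_tendsto_zero.2 (squeeze_zero (fun _ => dist_nonneg)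
        (g := fun b => C * (|b - a| + |h - h|))
        (fun b => (hφ h hh b).2.2.2 h hh a 1 ho) ?_)
      have : Continuous fun b => C * (|b - a| + |h - h|) := by fun_prop
      simpa using this.tendsto a)
    (fun a h hh => by
      refine ContinuousWithinAt.sub ?_ continuousWithinAt_const
      refine tendsto_iff_dist_tendsto_zero.2 (squeeze_zero' (Eventually.of_forall
        fun _ => dist_nonneg) (g := fun k => C * (|a - a| + |k - h|)) ?_ ?_)
      · filter_upwards [self_mem_nhdsWithin] with k hk using (hφ k hk a).2.2.2 h hh a 1 ho
      · have : Continuous fun k => C * (|a - a| + |k - h|) := by fun_prop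
        simpa using (this.tendsto h).mono_left nhdsWithin_le_nhds)
    (fun a h hh k hk hlt => by
      -- Trajectories with the same initial value and `h < k` can cross only upwards in their
      -- difference.
      have := pos_of_deriv_pos_of_eq_zero (e := fun y => φ a h y - φ a k y) zero_lt_one
        (fun y hy => ((hφ h hh a).2.1 y hy).sub ((hφ k hk a).2.1 y hy))
        (fun y hy hy0 => by
          rw [sub_eq_zero.1 hy0, slopeField_sub]
          exact mul_pos (by positivity) (by linarith))
        (by simp [(hφ h hh a).1, (hφ k hk a).1])
      simp only at this ⊢
      linarith)
    (fun a => by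
      obtain ⟨y, hy⟩ := hmv _ hSm a
      rw [hy, ← not_le, slopeField_le_zero_iff hd hr, not_le]
      linarith [eikonal_nonneg r (clip B (φ a (-S) y)), (abs_le.1 (hM y)).1])
    (fun a => by
      obtain ⟨y, hy⟩ := hmv _ hSp a
      rw [hy, ← not_le, zero_le_slopeField_iff hd hr, not_le]
      have h1 : eikonal r (clip B (φ a S y)) ≤ eikonal r B :=
        eikonal_le_eikonal ((abs_clip_le hB _).trans (le_abs_self B))
      linarith [(abs_le.1 (hM y)).2])
  have hii : ∀ a, IntervalIntegrable (φ a (h a)) MeasureTheory.volume 0 1 := fun a =>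
    ContinuousOn.intervalIntegrable (by
      rw [Set.uIcc_of_le zero_le_one]; exact hcontOn _ (hh a).1 a)
  have hmean : Continuous fun a => ∫ y in (0 : ℝ)..1, φ a (h a) y := by
    refine continuous_iff_continuousAt.2 fun a => tendsto_iff_dist_tendsto_zero.2
      (squeeze_zero (fun _ => dist_nonneg) (g := fun b => C * (|b - a| + |h b - h a|))
        (fun b => ?_) ?_)
    · rw [Real.dist_eq, ← intervalIntegral.integral_sub (hii b) (hii a)]
      exact abs_integral_le_of_abs_le fun y hy => (hφ _ (hh b).1 b).2.2.2 _ (hh a).1 a y hy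
    · have : Continuous fun b => C * (|b - a| + |h b - h a|) := by fun_prop
      simpa using this.tendsto a
  have hclose : ∀ a, |(∫ y in (0 : ℝ)..1, φ a (h a) y) - a| ≤ C := fun a => by
    have : (∫ y in (0 : ℝ)..1, φ a (h a) y) - a = ∫ y in (0 : ℝ)..1, (φ a (h a) y - a) := by
      rw [intervalIntegral.integral_sub (hii a) (by simp)]; simp
    rw [this]
    exact abs_integral_le_of_abs_le fun y hy => (hφ _ (hh a).1 a).2.2.1 y hy
  obtain ⟨a, -, ha⟩ := intermediate_value_Icc (a := μ - C) (b := μ + C) (by linarith)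
    hmean.continuousOn (show μ ∈ _ from
      ⟨by linarith [(abs_le.1 (hclose (μ - C))).2], by linarith [(abs_le.1 (hclose (μ + C))).1]⟩)
  obtain ⟨u, hup, hud, hue⟩ := exists_periodic_extension
    (F := fun y t => slopeField d r (h a) (f y) (clip B t)) (φ := φ a (h a))
    (continuous_slopeField_clip hf d r (h a) B) (fun y t => by simp [hfp y]) (hφ _ (hh a).1 a).2.1
    (by rw [(hφ _ (hh a).1 a).1]; linarith [(hh a).2])
  have huμ : ∫ y in (0 : ℝ)..1, u y = μ := by
    rw [← ha]
    refine intervalIntegral.integral_congr fun y hy => hue y ?_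
    rwa [Set.uIcc_of_le zero_le_one] at hy
  have hμB : |μ| ≤ B := by linarith [abs_le_eikonal r μ]
  refine ⟨h a, u, ⟨hup, fun y => ?_⟩, huμ⟩
  have h1 := eikonal_slope_le hd hr hM hup hud huμ (clip_eq_self hμB) (clip_mono B) y
  have h2 : |u y| ≤ B :=
    abs_le_of_abs_clip_lt ((abs_le_eikonal r _).trans_lt (by linarith))
  simpa [clip_eq_self h2] using hud y

/-! ### Dependence of the speed on the Markstein number -/

theorem hasDerivAt_of_abs_sub_le_sq {g : ℝ → ℝ} {a c K : ℝ}
    (h : ∀ᶠ x in 𝓝 a, |g x - g a - (x - a) * c| ≤ K * (x - a) ^ 2) : HasDerivAt g c a := by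
  rw [hasDerivAt_iff_isLittleO]
  have h1 : (fun x => g x - g a - (x - a) • c) =O[𝓝 a] fun x => (x - a) ^ 2 := by
    refine Asymptotics.IsBigO.of_bound K ?_
    filter_upwards [h] with x hx
    simpa using hx
  refine h1.trans_isLittleO ?_
  have h2 : (fun x : ℝ => (x - a) * (x - a)) =o[𝓝 a] fun x => 1 * (x - a) := by
    refine Asymptotics.IsLittleO.mul_isBigO ?_ (Asymptotics.isBigO_refl _ _)
    rw [Asymptotics.isLittleO_one_iff]
    have : Continuous fun x : ℝ => x - a := by fun_prop
    simpa using this.tendsto a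
  simpa [sq] using h2

/-- A scalar linear equation has, for a suitable multiple of the inhomogeneity, a solution that is
positive on `[0, 1]` and takes the same value at the end points. -/
theorem exists_positive_periodic_linear {β κ : ℝ → ℝ} (hβ : Continuous β) (hκ : Continuous κ)
    (hpos : ∀ y, 0 < κ y) :
    ∃ (ρ : ℝ → ℝ) (c : ℝ), (∀ y, HasDerivAt ρ (-(β y * ρ y + c * κ y)) y) ∧ ρ 0 = ρ 1 ∧
      ∀ y ∈ Set.Icc (0 : ℝ) 1, 0 < ρ y := by
  set b : ℝ → ℝ := fun y => ∫ x in (0 : ℝ)..y, β x with hb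
  have hbd : ∀ y, HasDerivAt b (β y) y := fun y => (hβ.integral_hasStrictDerivAt 0 y).hasDerivAt
  have hbc : Continuous b := continuous_iff_continuousAt.2 fun y => (hbd y).continuousAt
  set q : ℝ → ℝ := fun y => κ y * Real.exp (b y) with hq
  have hqc : Continuous q := by fun_prop
  have hqpos : ∀ y, 0 < q y := fun y => mul_pos (hpos y) (Real.exp_pos _)
  set I : ℝ → ℝ := fun y => ∫ x in (0 : ℝ)..y, q x with hI
  have hId : ∀ y, HasDerivAt I (q y) y := fun y => (hqc.integral_hasStrictDerivAt 0 y).hasDerivAt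
  have hI0 : I 0 = 0 := by simp [hI]
  have hmono : StrictMono I := strictMono_of_deriv_pos fun y => by
    rw [(hId y).deriv]; exact hqpos y
  have hb0 : b 0 = 0 := by simp [hb]
  -- Variation of constants with `ρ 0 = I 1`; the condition `ρ 1 = ρ 0` forces `1 - c = exp (b 1)`.
  -- In particular `c < 1`, which gives positivity.
  set c : ℝ := 1 - Real.exp (b 1) with hc
  refine ⟨fun y => Real.exp (-b y) * (I 1 - c * I y), c, fun y => ?_, ?_, fun y hy => ?_⟩
  · have h1 := ((hbd y).neg.exp).mul (((hId y).const_mul c).const_sub (I 1))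
    refine h1.congr_deriv ?_
    simp only [hq]
    have : Real.exp (-b y) * Real.exp (b y) = 1 := by rw [← Real.exp_add]; simp
    linear_combination (-c * κ y) * this
  · simp only [hb0, hI0, hc]
    have : Real.exp (-b 1) * Real.exp (b 1) = 1 := by rw [← Real.exp_add]; simp
    simp only [neg_zero, Real.exp_zero]
    linear_combination (-I 1) * this
  · refine mul_pos (Real.exp_pos _) ?_
    have h1 : 0 ≤ I y := by rw [← hI0]; exact hmono.monotone hy.1
    have h2 : I y ≤ I 1 := hmono.monotone hy.2
    have h3 : 0 < I 1 := by rw [← hI0]; exact hmono zero_lt_one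
    have h4 := Real.exp_pos (b 1)
    rcases h1.eq_or_lt with h | h
    · rw [← h]; simpa using h3
    · rw [hc]; nlinarith [mul_pos h4 h]

/-- Expresses the angle through its sine `t / eikonal r t`, the quantity that appears as a
coefficient in the adjoint equation. -/
theorem curvAngle_eq {r : ℝ} (hr : 0 < r) (t : ℝ) :
    curvAngle r t = r * Real.arcsin (t / eikonal r t) := by
  rw [curvAngle, Real.arctan_eq_arcsin, eikonal]
  congr 2
  have : √(1 + (t / r) ^ 2) = √(r ^ 2 + t ^ 2) / r := by
    rw [eq_div_iff hr.ne', ← Real.sqrt_sq hr.le, ← Real.sqrt_mul (by positivity),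
      Real.sqrt_sq hr.le]
    congr 1
    field_simp
  rw [this]
  field_simp

theorem div_eikonal_mem_Ioo {r : ℝ} (hr : 0 < r) (t : ℝ) : t / eikonal r t ∈ Set.Ioo (-1) 1 := by
  have hE := eikonal_pos hr t
  have h1 : |t| < eikonal r t := by
    refine lt_of_pow_lt_pow_left₀ 2 hE.le ?_
    rw [eikonal_sq, sq_abs]
    nlinarith [sq_pos_of_pos hr]
  have h2 := abs_lt.1 h1
  refine ⟨?_, ?_⟩
  · rw [lt_div_iff₀ hE]; linarith
  · rw [div_lt_iff₀ hE]; linarith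

theorem curvAngle_injective {r : ℝ} (hr : 0 < r) : Function.Injective (curvAngle r) := by
  intro s t h
  have := Real.arctan_injective (mul_left_cancel₀ hr.ne' h)
  field_simp at this
  exact this

theorem arcsin_sub_mul_sub_nonneg (x y : ℝ) : 0 ≤ (Real.arcsin x - Real.arcsin y) * (x - y) := by
  rcases le_total x y with h | h
  · exact mul_nonneg_of_nonpos_of_nonpos (by linarith [Real.monotone_arcsin h]) (by linarith)
  · exact mul_nonneg (by linarith [Real.monotone_arcsin h]) (by linarith)

/-- No restriction on `y` is needed: outside `(-1, 1)` the function `Real.arcsin` takes only the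
values `±π / 2`. Below, `y = -c / ρ` may leave `[-1, 1]`. -/
theorem eq_of_arcsin_eq {x y : ℝ} (hx : x ∈ Set.Ioo (-1 : ℝ) 1)
    (h : Real.arcsin x = Real.arcsin y) : x = y := by
  have h1 : Real.arcsin x ∈ Set.Ioo (-(Real.pi / 2)) (Real.pi / 2) :=
    ⟨Real.neg_pi_div_two_lt_arcsin.2 hx.1, Real.arcsin_lt_pi_div_two.2 hx.2⟩
  have := (Real.arcsin_eq_iff_eq_sin h1).1 h.symm
  rw [this, Real.sin_arcsin hx.1.le hx.2.le]

/-- The coefficient in the adjoint linearized equation. -/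
noncomputable def adjCoeff (d r t : ℝ) : ℝ := (r ^ 2 + t ^ 2) / (d * r ^ 2)

theorem adjCoeff_pos {d r : ℝ} (hd : 0 < d) (hr : 0 < r) (t : ℝ) : 0 < adjCoeff d r t := by
  unfold adjCoeff; positivity

/-- The weight `ρ` solving the adjoint linearized equation along a non-constant slope `u` is
negatively correlated with the angle of `u`. -/
theorem integral_adjoint_deriv_mul_curvAngle_neg {d r c : ℝ} (hd : 0 < d) (hr : 0 < r)
    {u ρ : ℝ → ℝ} (hu : Continuous u) (hnc : ∃ y ∈ Set.Icc (0 : ℝ) 1, u y ≠ u 0)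
    (hρ : ∀ y, HasDerivAt ρ (-(adjCoeff d r (u y) * (u y / eikonal r (u y)) * ρ y
      + c * adjCoeff d r (u y))) y)
    (h01 : ρ 0 = ρ 1) (hpos : ∀ y ∈ Set.Icc (0 : ℝ) 1, 0 < ρ y) :
    ∫ y in (0 : ℝ)..1, deriv ρ y * curvAngle r (u y) < 0 := by
  have hρc : Continuous ρ := continuous_iff_continuousAt.2 fun y => (hρ y).continuousAt
  have hac : Continuous fun y => adjCoeff d r (u y) := by unfold adjCoeff; fun_prop
  have hEc : Continuous fun y => u y / eikonal r (u y) :=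
    hu.div ((continuous_eikonal r).comp hu) fun y => (eikonal_pos hr _).ne'
  have hρ' : deriv ρ = fun y => -(adjCoeff d r (u y) * (u y / eikonal r (u y)) * ρ y
      + c * adjCoeff d r (u y)) := funext fun y => (hρ y).deriv
  have hρ'c : Continuous (deriv ρ) := by rw [hρ']; fun_prop
  have hAc : Continuous fun y => curvAngle r (u y) := (continuous_curvAngle r).comp hu
  have hgc : ContinuousOn (fun x => r * Real.arcsin (-c / x)) (Set.Ioi 0) :=
    continuousOn_const.mul (Real.continuous_arcsin.comp_continuousOn
      (continuousOn_const.div continuousOn_id fun x hx => (Set.mem_Ioi.1 hx).ne'))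
  have hmaps : ∀ y ∈ Set.Icc (0 : ℝ) 1, ρ y ∈ Set.Ioi (0 : ℝ) := hpos
  -- A function of `ρ` times `ρ'` is an exact derivative, and `ρ 0 = ρ 1`. Subtracting it turns the
  -- correlation into an integral of one sign.
  have hexact : ∫ y in (0 : ℝ)..1, (fun x => r * Real.arcsin (-c / x)) (ρ y) * deriv ρ y = 0 := by
    have h := intervalIntegral.integral_comp_mul_deriv'' (a := 0) (b := 1) (f := ρ)
      (f' := deriv ρ) (g := fun x => r * Real.arcsin (-c / x)) hρc.continuousOn
      (fun y _ => (hρ y).differentiableAt.hasDerivAt.hasDerivWithinAt) hρ'c.continuousOn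
      (hgc.mono (by
        rintro _ ⟨y, hy, rfl⟩
        rw [Set.uIcc_of_le zero_le_one] at hy
        exact hmaps y hy))
    rw [h01, intervalIntegral.integral_same] at h
    exact h
  have hgρ : ContinuousOn (fun y => (fun x => r * Real.arcsin (-c / x)) (ρ y)) (Set.Icc 0 1) :=
    hgc.comp hρc.continuousOn hmaps
  have hfac : ∀ y ∈ Set.Icc (0 : ℝ) 1, deriv ρ y =
      -(adjCoeff d r (u y) * ρ y * (u y / eikonal r (u y) - -c / ρ y)) := fun y hy => by
    rw [hρ']
    have := (hpos y hy).ne'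
    field_simp
    ring
  have hform : ∀ y ∈ Set.Icc (0 : ℝ) 1,
      (r * Real.arcsin (-c / ρ y) - curvAngle r (u y)) * deriv ρ y
        = r * (adjCoeff d r (u y) * ρ y)
          * ((Real.arcsin (u y / eikonal r (u y)) - Real.arcsin (-c / ρ y))
            * (u y / eikonal r (u y) - -c / ρ y)) := fun y hy => by
    rw [hfac y hy, curvAngle_eq hr]; ring
  have hnn : ∀ y ∈ Set.Icc (0 : ℝ) 1,
      0 ≤ (r * Real.arcsin (-c / ρ y) - curvAngle r (u y)) * deriv ρ y := fun y hy => by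
    rw [hform y hy]
    have := adjCoeff_pos hd hr (u y)
    have := hpos y hy
    exact mul_nonneg (by positivity) (arcsin_sub_mul_sub_nonneg _ _)
  have hlt : ∃ y ∈ Set.Icc (0 : ℝ) 1,
      0 < (r * Real.arcsin (-c / ρ y) - curvAngle r (u y)) * deriv ρ y := by
    -- In the equality case `u / eikonal r u = -c / ρ` throughout, so `ρ' = 0`; then `ρ`, and with
    -- it the angle and `u`, is constant.
    by_contra! hcon
    have heq : ∀ y ∈ Set.Icc (0 : ℝ) 1, u y / eikonal r (u y) = -c / ρ y := fun y hy => by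
      have h0 := le_antisymm (hcon y hy) (hnn y hy)
      rw [hform y hy] at h0
      have h1 := adjCoeff_pos hd hr (u y)
      have h2 := hpos y hy
      rcases mul_eq_zero.1 ((mul_eq_zero.1 h0).resolve_left (by positivity)) with h | h
      · exact eq_of_arcsin_eq (div_eikonal_mem_Ioo hr _) (sub_eq_zero.1 h)
      · exact sub_eq_zero.1 h
    have hconst : ∀ y ∈ Set.Icc (0 : ℝ) 1, ρ y = ρ 0 :=
      constant_of_has_deriv_right_zero hρc.continuousOn fun y hy => by
        have hy' : y ∈ Set.Icc (0 : ℝ) 1 := ⟨hy.1, hy.2.le⟩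
        have h1 := (hρ y).differentiableAt.hasDerivAt
        rw [hfac y hy', heq y hy', sub_self, mul_zero, neg_zero] at h1
        exact h1.hasDerivWithinAt
    obtain ⟨y, hy, hne⟩ := hnc
    apply hne
    apply curvAngle_injective hr
    rw [curvAngle_eq hr, curvAngle_eq hr, heq y hy, heq 0 ⟨le_rfl, zero_le_one⟩, hconst y hy]
  have hint1 : IntervalIntegrable (fun y => (r * Real.arcsin (-c / ρ y)) * deriv ρ y)
      MeasureTheory.volume 0 1 := by
    refine ContinuousOn.intervalIntegrable ?_
    rw [Set.uIcc_of_le zero_le_one]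
    exact hgρ.mul hρ'c.continuousOn
  have hint2 : IntervalIntegrable (fun y => deriv ρ y * curvAngle r (u y))
      MeasureTheory.volume 0 1 := (hρ'c.mul hAc).intervalIntegrable _ _
  have hpos' := intervalIntegral.integral_pos zero_lt_one
    ((hgρ.sub hAc.continuousOn).mul hρ'c.continuousOn)
    (fun y hy => hnn y ⟨hy.1.le, hy.2⟩) hlt
  have hsplit : ∫ y in (0 : ℝ)..1, (r * Real.arcsin (-c / ρ y) - curvAngle r (u y)) * deriv ρ y
      = (∫ y in (0 : ℝ)..1, (r * Real.arcsin (-c / ρ y)) * deriv ρ y)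
        - ∫ y in (0 : ℝ)..1, deriv ρ y * curvAngle r (u y) := by
    rw [← intervalIntegral.integral_sub hint1 hint2]
    exact intervalIntegral.integral_congr fun y _ => by ring
  have := hpos'.trans_eq (hsplit.trans (congrArg (· - _) hexact))
  simp only [zero_sub] at this
  linarith

/-- A bound for the residual `√(r² + u²) + f - H` along slopes of mean `μ`, where `|f| ≤ M`. -/
noncomputable def residualBound (r μ M : ℝ) : ℝ := 2 * eikonal r μ + 4 * M

theorem IsSlope.abs_residual_le {f u : ℝ → ℝ} {d r H M μ : ℝ} (h : IsSlope f d r H u) (hd : 0 < d)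
    (hr : 0 < r) (hM : ∀ y, |f y| ≤ M) (hμ : ∫ y in (0 : ℝ)..1, u y = μ) (y : ℝ) :
    |eikonal r (u y) + f y - H| ≤ residualBound r μ M := by
  have h1 := eikonal_slope_le (κ := id) hd hr hM h.periodic h.hasDerivAt hμ rfl monotone_id y
  have h2 := abs_le.1 (h.abs_speed_sub_le hd hr hM hμ)
  have h3 := eikonal_nonneg r (u y)
  have h4 := abs_le.1 (hM y)
  have h5 := eikonal_nonneg r μ
  simp only [id] at h1
  unfold residualBound
  exact abs_le.2 ⟨by linarith, by linarith⟩

theorem residualBound_nonneg {r μ M : ℝ} (hM : 0 ≤ M) : 0 ≤ residualBound r μ M := by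
  have := eikonal_nonneg r μ
  unfold residualBound; positivity

theorem slopeField_eq (d r H s t : ℝ) :
    slopeField d r H s t = (r ^ 2 + t ^ 2) / r ^ 2 * ((eikonal r t + s - H) / d) := by
  unfold slopeField; ring

/-- Divergence form of the slope equation: the factor `r² + u²` disappears, so it can be integrated
over a period or tested with a weight. -/
theorem IsSlope.hasDerivAt_curvAngle {f u : ℝ → ℝ} {d r H : ℝ} (h : IsSlope f d r H u)
    (hr : 0 < r) (y : ℝ) :
    HasDerivAt (fun y => curvAngle r (u y)) ((eikonal r (u y) + f y - H) / d) y := by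
  refine ((_root_.hasDerivAt_curvAngle hr (u y)).comp y (h.hasDerivAt y)).congr_deriv ?_
  rw [slopeField_eq]
  field_simp

theorem exists_eq_of_integral_eq {u u' : ℝ → ℝ} (hc : Continuous u) (hc' : Continuous u')
    (hμ : ∫ y in (0 : ℝ)..1, u y = ∫ y in (0 : ℝ)..1, u' y) : ∃ y, u y - u' y = 0 :=
  exists_eq_zero_of_integral_eq_zero (hc.sub hc') (by
    rw [intervalIntegral.integral_sub (hc.intervalIntegrable _ _) (hc'.intervalIntegrable _ _), hμ,
      sub_self])

/-- The speed is locally Lipschitz in the Markstein number. -/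
theorem IsSlope.abs_speed_sub_speed_le {f u u' : ℝ → ℝ} {d d' r H H' M μ : ℝ}
    (h : IsSlope f d r H u) (h' : IsSlope f d' r H' u') (hd : 0 < d) (hd' : 0 < d') (hr : 0 < r)
    (hM : ∀ y, |f y| ≤ M) (hμ : ∫ y in (0 : ℝ)..1, u y = μ) (hμ' : ∫ y in (0 : ℝ)..1, u' y = μ) :
    |H' - H| ≤ residualBound r μ M / d * |d' - d| := by
  have hc := h.continuous
  have hc' := h'.continuous
  have hz := exists_eq_of_integral_eq hc' hc (hμ'.trans hμ.symm)
  have hp : Function.Periodic (fun y => u' y - u y) 1 := fun y => by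
    simp [h.periodic y, h'.periodic y]
  have hder := fun y => (h'.hasDerivAt y).sub (h.hasDerivAt y)
  -- Where the slopes cross, both fields see the same slope, and the sign of their difference
  -- compares `H' - H` with `d' - d` times a bounded residual.
  have hkey : ∀ y, slopeField d' r H' (f y) (u y) - slopeField d r H (f y) (u y)
      = (r ^ 2 + u y ^ 2) / r ^ 2 / d' *
        (-(H' - H) - (d' - d) * ((eikonal r (u y) + f y - H) / d)) := fun y => by
    unfold slopeField
    field_simp
    ring
  have hbd : ∀ y, |(d' - d) * ((eikonal r (u y) + f y - H) / d)|
      ≤ residualBound r μ M / d * |d' - d| := fun y => by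
    rw [abs_mul, abs_div, abs_of_pos hd, mul_comm]
    gcongr
    exact h.abs_residual_le hd hr hM hμ y
  obtain ⟨y, hy, hy'⟩ := hp.exists_eq_zero_deriv_nonpos hder hz
  obtain ⟨x, hx, hx'⟩ := hp.exists_eq_zero_deriv_nonneg hder hz
  rw [sub_eq_zero.1 hy, hkey] at hy'
  rw [sub_eq_zero.1 hx, hkey] at hx'
  have h1 : 0 < (r ^ 2 + u y ^ 2) / r ^ 2 / d' := by positivity
  have h2 : 0 < (r ^ 2 + u x ^ 2) / r ^ 2 / d' := by positivity
  have h3 := nonneg_of_mul_nonneg_right hx' h2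
  have h4 : -(H' - H) - (d' - d) * ((eikonal r (u y) + f y - H) / d) ≤ 0 := by
    by_contra! hcon
    exact absurd hy' (not_le.2 (mul_pos h1 hcon))
  have h5 := abs_le.1 (hbd y)
  have h6 := abs_le.1 (hbd x)
  exact abs_le.2 ⟨by linarith, by linarith⟩

/-- The slope is locally Lipschitz in the Markstein number, uniformly in the position. -/
theorem IsSlope.exists_abs_sub_le {f u : ℝ → ℝ} {d r H M μ : ℝ} (h : IsSlope f d r H u)
    (hd : 0 < d) (hr : 0 < r) (hM : ∀ y, |f y| ≤ M) (hμ : ∫ y in (0 : ℝ)..1, u y = μ) :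
    ∃ C, 0 ≤ C ∧ ∀ d' H' u', d / 2 ≤ d' → IsSlope f d' r H' u' → ∫ y in (0 : ℝ)..1, u' y = μ →
      ∀ y, |u' y - u y| ≤ C * |d' - d| := by
  have hM0 : 0 ≤ M := (abs_nonneg _).trans (hM 0)
  have hE := eikonal_nonneg r μ
  set Q := residualBound r μ M with hQ
  have hQ0 : 0 ≤ Q := residualBound_nonneg hM0
  set B := eikonal r μ + 2 * M with hB
  have hB0 : 0 ≤ B := by positivity
  set K := slopeLip d r B (M + |H|) with hK
  have hK0 : 0 ≤ K := by
    have := eikonal_nonneg r B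
    rw [hK, slopeLip]; positivity
  -- The factor `3` is `2 + 1`: `1 / (d d') ≤ 2 / d²` because `d / 2 ≤ d'`, and the change of speed
  -- contributes `Q / d²`.
  set C₁ := (r ^ 2 + B ^ 2) / r ^ 2 * (3 * Q / d ^ 2) with hC₁
  have hC₁0 : 0 ≤ C₁ := by positivity
  refine ⟨C₁ * Real.exp (K + 1), by positivity, fun d' H' u' hd' h' hμ' => ?_⟩
  have hd'0 : 0 < d' := by linarith
  have hc := h.continuous
  have hc' := h'.continuous
  obtain ⟨z, hz⟩ := exists_eq_of_integral_eq hc' hc (hμ'.trans hμ.symm)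
  have hp : Function.Periodic (fun y => u' y - u y) 1 := fun y => by
    simp [h.periodic y, h'.periodic y]
  have hHH := h.abs_speed_sub_speed_le h' hd hd'0 hr hM hμ hμ'
  have hB1 : ∀ y, |u y| ≤ B := h.abs_slope_le hd hr hM hμ
  have hB2 : ∀ y, |u' y| ≤ B := h'.abs_slope_le hd'0 hr hM hμ'
  have key := abs_le_of_abs_deriv_le (e := fun y => u' y - u y) (a := z) (b := z + 1)
      (K := K + 1) (δ := 0) (ε := C₁ * |d' - d|) (by linarith) (by positivity)
      (fun x hx => (h'.hasDerivAt x).sub (h.hasDerivAt x)) (by simp [hz]) (fun x hx => ?_)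
  · intro y
    obtain ⟨x, hx, hxy⟩ := hp.exists_mem_Ico one_pos y z
    have hxy' : u' y - u y = u' x - u x := hxy
    rw [hxy']
    refine (key x ⟨hx.1, hx.2.le⟩).trans (le_of_eq ?_)
    rw [zero_add, add_sub_cancel_left, mul_one]
    ring
  · have e : slopeField d' r H' (f x) (u' x) - slopeField d r H (f x) (u x)
        = (slopeField d r H (f x) (u' x) - slopeField d r H (f x) (u x))
          + (r ^ 2 + u' x ^ 2) / r ^ 2 * ((eikonal r (u' x) + f x - H') * ((d - d') / (d * d'))
            + (H - H') / d) := by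
      unfold slopeField
      field_simp
      ring
    rw [e]
    refine (abs_add_le _ _).trans (add_le_add ?_ ?_)
    · refine (abs_slopeField_sub_le hd hr (hB2 x) (hB1 x) (S := M + |H|)
        ((abs_sub _ _).trans (by linarith [hM x]))).trans ?_
      nlinarith [abs_nonneg (u' x - u x)]
    · rw [abs_mul, abs_of_nonneg (by positivity), hC₁, mul_assoc]
      refine mul_le_mul ?_ ?_ (abs_nonneg _) (by positivity)
      · have := sq_le_sq.2 ((hB2 x).trans (le_abs_self B))
        exact div_le_div_of_nonneg_right (by linarith) (by positivity)
      · refine (abs_add_le _ _).trans ?_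
        have h1 : |(eikonal r (u' x) + f x - H') * ((d - d') / (d * d'))|
            ≤ Q * (|d' - d| * (2 / d ^ 2)) := by
          rw [abs_mul, abs_div, abs_sub_comm d d', abs_of_pos (by positivity : 0 < d * d')]
          refine mul_le_mul (h'.abs_residual_le hd'0 hr hM hμ' x) ?_ (by positivity) hQ0
          rw [div_eq_mul_inv]
          refine mul_le_mul_of_nonneg_left ?_ (abs_nonneg _)
          rw [inv_eq_one_div, div_le_div_iff₀ (by positivity) (by positivity)]
          nlinarith
        have h2 : |(H - H') / d| ≤ Q / d * |d' - d| / d := by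
          rw [abs_div, abs_of_pos hd, abs_sub_comm]
          gcongr
        calc _ ≤ Q * (|d' - d| * (2 / d ^ 2)) + Q / d * |d' - d| / d := add_le_add h1 h2
          _ = _ := by field_simp; ring

theorem abs_curvAngle_sub_le {r : ℝ} (hr : 0 < r) (s t : ℝ) :
    |curvAngle r s - curvAngle r t| ≤ |s - t| := by
  have := convex_univ.norm_image_sub_le_of_norm_hasDerivWithin_le (C := 1)
    (fun x (_ : x ∈ Set.univ) => (hasDerivAt_curvAngle hr x).hasDerivWithinAt) (fun x _ => ?_)
    (Set.mem_univ t) (Set.mem_univ s)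
  · simpa using this
  · rw [Real.norm_eq_abs, abs_of_nonneg (by positivity), div_le_one (by positivity)]
    nlinarith [sq_nonneg x]

/-- The speed is differentiable in the Markstein number with negative derivative. -/
theorem exists_hasDerivAt_speed_neg {f : ℝ → ℝ} {r μ : ℝ} (hr : 0 < r) (hf : Continuous f)
    (hfp : Function.Periodic f 1) (hnc : ¬ ∃ c, ∀ y, f y = c) {Hs : ℝ → ℝ} {us : ℝ → ℝ → ℝ}
    (hs : ∀ d, 0 < d → IsSlope f d r (Hs d) (us d))
    (hμ : ∀ d, 0 < d → ∫ y in (0 : ℝ)..1, us d y = μ) {d : ℝ} (hd : 0 < d) :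
    ∃ c < 0, HasDerivAt Hs c d := by
  obtain ⟨M, hM0, hM⟩ := hfp.exists_abs_le hf
  set u := us d with hu
  set H := Hs d with hH
  have h : IsSlope f d r H u := hs d hd
  have huc := h.continuous
  have hac : Continuous fun y => adjCoeff d r (u y) := by unfold adjCoeff; fun_prop
  have hEc : Continuous fun y => u y / eikonal r (u y) :=
    huc.div ((continuous_eikonal r).comp huc) fun y => (eikonal_pos hr _).ne'
  obtain ⟨ρ, c, hρ, h01, hpos⟩ := exists_positive_periodic_linear
    (β := fun y => adjCoeff d r (u y) * (u y / eikonal r (u y))) (hac.mul hEc) hac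
    (fun y => adjCoeff_pos hd hr (u y))
  have hρc : Continuous ρ := continuous_iff_continuousAt.2 fun y => (hρ y).continuousAt
  have hρ' : deriv ρ = fun y => -(adjCoeff d r (u y) * (u y / eikonal r (u y)) * ρ y
      + c * adjCoeff d r (u y)) := funext fun y => (hρ y).deriv
  have hρ'c : Continuous (deriv ρ) := by rw [hρ']; fun_prop
  -- The first variation tested with `ρ` is a constant multiple of `u' - u`, which integrates to
  -- zero because the means agree.
  have hadj : ∀ y, d * (r ^ 2 / (r ^ 2 + u y ^ 2)) * deriv ρ y + u y / eikonal r (u y) * ρ y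
      = -c := fun y => by
    rw [hρ']
    have := eikonal_pos hr (u y)
    simp only [adjCoeff]
    field_simp
    ring
  -- A constant slope makes the field vanish identically, hence makes `f` constant.
  have hnc' : ∃ y ∈ Set.Icc (0 : ℝ) 1, u y ≠ u 0 := by
    by_contra! hcon
    apply hnc
    have hconst : ∀ y, u y = u 0 := fun y => by
      obtain ⟨x, hx, hxy⟩ := h.periodic.exists_mem_Ico₀ one_pos y
      rw [hxy, hcon x ⟨hx.1, hx.2.le⟩]
    refine ⟨H - eikonal r (u 0), fun y => ?_⟩
    have h1 := h.hasDerivAt y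
    have h2 : HasDerivAt u 0 y := by
      rw [show u = fun _ => u 0 from funext hconst]; exact hasDerivAt_const _ _
    have h3 := h1.unique h2
    have h4 := (slopeField_le_zero_iff hd hr).1 h3.le
    have h5 := (zero_le_slopeField_iff hd hr).1 h3.ge
    rw [hconst y] at h4 h5
    linarith
  have hneg := integral_adjoint_deriv_mul_curvAngle_neg hd hr huc hnc' hρ h01 hpos
  set I := ∫ y in (0 : ℝ)..1, ρ y with hI
  have hIpos : 0 < I := intervalIntegral.intervalIntegral_pos_of_pos_on
    (hρc.intervalIntegrable _ _) (fun y hy => hpos y ⟨hy.1.le, hy.2.le⟩) zero_lt_one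
  set J := ∫ y in (0 : ℝ)..1, deriv ρ y * curvAngle r (u y) with hJ
  obtain ⟨C, hC0, hC⟩ := h.exists_abs_sub_le hd hr hM (hμ d hd)
  obtain ⟨R, hR⟩ := (isCompact_Icc (a := (0 : ℝ)) (b := 1)).exists_bound_of_continuousOn
    hρc.continuousOn
  obtain ⟨R', hR'⟩ := (isCompact_Icc (a := (0 : ℝ)) (b := 1)).exists_bound_of_continuousOn
    hρ'c.continuousOn
  simp only [Real.norm_eq_abs] at hR hR'
  have hz : (0 : ℝ) ∈ Set.Icc (0 : ℝ) 1 := ⟨le_rfl, zero_le_one⟩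
  have hR0 : 0 ≤ R := (abs_nonneg _).trans (hR 0 hz)
  have hR'0 : 0 ≤ R' := (abs_nonneg _).trans (hR' 0 hz)
  refine ⟨J / I, div_neg_of_neg_of_pos hneg hIpos, hasDerivAt_of_abs_sub_le_sq
    (K := ((R + d * R') * (C ^ 2 / r) + R' * C) / I) ?_⟩
  filter_upwards [lt_mem_nhds (show d / 2 < d by linarith)] with d' hd'
  have hd'0 : 0 < d' := by linarith
  set u' := us d'
  set H' := Hs d'
  have h' : IsSlope f d' r H' u' := hs d' hd'0
  have huc' := h'.continuous
  have hclose := hC d' H' u' hd'.le h' (hμ d' hd'0)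
  have hAc : Continuous fun y => curvAngle r (u y) := (continuous_curvAngle r).comp huc
  have hAc' : Continuous fun y => curvAngle r (u' y) := (continuous_curvAngle r).comp huc'
  have hEu : Continuous fun y => eikonal r (u y) := (continuous_eikonal r).comp huc
  have hEu' : Continuous fun y => eikonal r (u' y) := (continuous_eikonal r).comp huc'
  -- The divergence form tested with `ρ`; the boundary terms cancel by periodicity.
  have hparts : ∀ {a H : ℝ} {w : ℝ → ℝ}, 0 < a → IsSlope f a r H w →
      ∫ y in (0 : ℝ)..1, ρ y * (eikonal r (w y) + f y - H)
        = -(a * ∫ y in (0 : ℝ)..1, deriv ρ y * curvAngle r (w y)) := by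
    intro a H w ha hw
    have hwc := hw.continuous
    have hEw : Continuous fun y => eikonal r (w y) := (continuous_eikonal r).comp hwc
    have := intervalIntegral.integral_mul_deriv_eq_deriv_mul (a := 0) (b := 1)
      (fun y _ => (hρ y).differentiableAt.hasDerivAt) (fun y _ => hw.hasDerivAt_curvAngle hr y)
      (hρ'c.intervalIntegrable _ _)
      (((hEw.add hf).sub continuous_const).div_const a |>.intervalIntegrable _ _)
    have hw01 : w 1 = w 0 := by simpa using hw.periodic 0
    rw [h01, hw01, sub_self, zero_sub] at this
    rw [← mul_neg, ← this, ← intervalIntegral.integral_const_mul]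
    refine intervalIntegral.integral_congr fun y _ => ?_
    field_simp
  have e1 := hparts hd h
  have e2 := hparts hd'0 h'
  have hmean0 : ∫ y in (0 : ℝ)..1, c * (u' y - u y) = 0 := by
    rw [intervalIntegral.integral_const_mul, intervalIntegral.integral_sub
      (huc'.intervalIntegrable _ _) (huc.intervalIntegrable _ _), hμ d hd, hμ d' hd'0, sub_self,
      mul_zero]
  have hExp : (H' - H - (d' - d) * (J / I)) * I
      = ∫ y in (0 : ℝ)..1, (ρ y * (eikonal r (u' y) - eikonal r (u y)
            - u y / eikonal r (u y) * (u' y - u y))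
          + d * deriv ρ y * (curvAngle r (u' y) - curvAngle r (u y)
            - r ^ 2 / (r ^ 2 + u y ^ 2) * (u' y - u y))
          + (d' - d) * deriv ρ y * (curvAngle r (u' y) - curvAngle r (u y))) := by
    have ii : ∀ {g : ℝ → ℝ}, Continuous g → IntervalIntegrable g MeasureTheory.volume 0 1 :=
      fun hg => hg.intervalIntegrable _ _
    have hfun : ∀ y, (ρ y * (eikonal r (u' y) - eikonal r (u y)
            - u y / eikonal r (u y) * (u' y - u y))
          + d * deriv ρ y * (curvAngle r (u' y) - curvAngle r (u y)
            - r ^ 2 / (r ^ 2 + u y ^ 2) * (u' y - u y))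
          + (d' - d) * deriv ρ y * (curvAngle r (u' y) - curvAngle r (u y)))
        = ((((ρ y * (eikonal r (u' y) + f y - H') - ρ y * (eikonal r (u y) + f y - H))
          + (H' - H) * ρ y) + (d' * (deriv ρ y * curvAngle r (u' y))
          - d' * (deriv ρ y * curvAngle r (u y)))) + c * (u' y - u y)) := fun y => by
      linear_combination (-(u' y - u y)) * hadj y
    rw [intervalIntegral.integral_congr fun y _ => hfun y,
      intervalIntegral.integral_add (ii (by fun_prop)) (ii (by fun_prop)),
      intervalIntegral.integral_add (ii (by fun_prop)) (ii (by fun_prop)),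
      intervalIntegral.integral_add (ii (by fun_prop)) (ii (by fun_prop)),
      intervalIntegral.integral_sub (ii (by fun_prop)) (ii (by fun_prop)),
      intervalIntegral.integral_sub (ii (by fun_prop)) (ii (by fun_prop)), hmean0, e1, e2,
      intervalIntegral.integral_const_mul, intervalIntegral.integral_const_mul,
      intervalIntegral.integral_const_mul, ← hJ, ← hI]
    field_simp
    ring
  -- All three terms are quadratic in `d' - d`: two Taylor remainders with `|u' - u| ≤ C |d' - d|`,
  -- and `d' - d` times a difference of angles.
  have hbound : |(H' - H - (d' - d) * (J / I)) * I|
      ≤ ((R + d * R') * (C ^ 2 / r) + R' * C) * (d' - d) ^ 2 := by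
    rw [hExp]
    refine abs_integral_le_of_abs_le fun y hy => ?_
    have hζ := hclose y
    have hζ2 : (u' y - u y) ^ 2 / r ≤ C ^ 2 / r * (d' - d) ^ 2 := by
      rw [div_mul_eq_mul_div]
      refine div_le_div_of_nonneg_right ?_ hr.le
      rw [← sq_abs, ← sq_abs (d' - d), ← mul_pow]
      exact pow_le_pow_left₀ (abs_nonneg _) hζ 2
    have hsq0 : 0 ≤ C ^ 2 / r * (d' - d) ^ 2 := by positivity
    have t1 : |ρ y * (eikonal r (u' y) - eikonal r (u y) - u y / eikonal r (u y) * (u' y - u y))|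
        ≤ R * (C ^ 2 / r * (d' - d) ^ 2) := by
      rw [abs_mul]
      exact mul_le_mul (hR y hy) ((abs_eikonal_sub_sub_le hr _ _).trans hζ2) (abs_nonneg _) hR0
    have t2 : |d * deriv ρ y * (curvAngle r (u' y) - curvAngle r (u y)
        - r ^ 2 / (r ^ 2 + u y ^ 2) * (u' y - u y))| ≤ d * R' * (C ^ 2 / r * (d' - d) ^ 2) := by
      rw [abs_mul, abs_mul, abs_of_pos hd]
      exact mul_le_mul (mul_le_mul_of_nonneg_left (hR' y hy) hd.le)
        ((abs_curvAngle_sub_sub_le hr _ _).trans hζ2) (abs_nonneg _) (by positivity)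
    have t3 : |(d' - d) * deriv ρ y * (curvAngle r (u' y) - curvAngle r (u y))|
        ≤ |d' - d| * R' * (C * |d' - d|) := by
      rw [abs_mul, abs_mul]
      exact mul_le_mul (mul_le_mul_of_nonneg_left (hR' y hy) (abs_nonneg _))
        ((abs_curvAngle_sub_le hr _ _).trans hζ) (abs_nonneg _) (by positivity)
    calc _ ≤ _ := abs_add_three _ _ _
      _ ≤ R * (C ^ 2 / r * (d' - d) ^ 2) + d * R' * (C ^ 2 / r * (d' - d) ^ 2)
          + |d' - d| * R' * (C * |d' - d|) := by linarith
      _ = _ := by rw [← sq_abs (d' - d)]; ring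
  rw [abs_mul, abs_of_pos hIpos, ← le_div_iff₀ hIpos] at hbound
  refine hbound.trans (le_of_eq ?_)
  ring

/-! ### Existence for the inviscid cell problem -/

/-- A primitive of a function of modulus `g`, with the sign changing only from `+` to `-` where `g`
does not vanish, is a viscosity solution of the eikonal equation. -/
theorem isViscositySolution_of_abs_sub_le {γ μ H : ℝ} {f g w : ℝ → ℝ} (hg : Continuous g)
    (hg0 : ∀ y, 0 ≤ g y) (hgE : ∀ y, eikonal γ (g y) = H - f y) (hw : Continuous w)
    (h₁ : ∀ x y, |(w x + μ * x) - (w y + μ * y)| ≤ |∫ z in y..x, g z|)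
    (h₂ : ∀ y, g y = 0 ∨ HasDerivWithinAt w (g y - μ) (Set.Iio y) y ∨
      HasDerivWithinAt w (-g y - μ) (Set.Ioi y) y) :
    IsViscositySolution (fun y q => eikonal γ (μ + q) + f y - H) w := by
  refine ⟨⟨hw, fun φ hφ y hmax => ?_⟩, ⟨hw, fun φ hφ y hmin => ?_⟩⟩
  · have hφd : HasDerivAt φ (deriv φ y) y :=
      ((hφ.differentiable one_ne_zero) y).hasDerivAt
    have hGd : HasDerivAt (fun x => ∫ z in y..x, g z) (g y) y :=
      (hg.integral_hasStrictDerivAt y y).hasDerivAt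
    have hlin : HasDerivAt (fun x => μ * x) μ y := by
      simpa using (hasDerivAt_id y).const_mul μ
    -- At a maximum of `w - φ`, the bound on increments of `w + μ x` from the right and from the
    -- left gives `|μ + φ'| ≤ g`.
    have hr : 0 ≤ deriv φ y + μ + g y := by
      refine nonneg_of_hasDerivWithinAt_Ioi ((hφd.add hlin).add hGd).hasDerivWithinAt ?_
      filter_upwards [self_mem_nhdsWithin, nhdsWithin_le_nhds hmax] with x hx hmx
      have hG : 0 ≤ ∫ z in y..x, g z :=
        intervalIntegral.integral_nonneg (Set.mem_Ioi.1 hx).le fun z _ => hg0 z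
      have h3 := h₁ x y
      rw [abs_of_nonneg hG] at h3
      have h4 := (abs_le.1 h3).1
      simp only [Pi.add_apply, intervalIntegral.integral_same]
      have h5 : w x - φ x ≤ w y - φ y := hmx
      linarith
    have hl : deriv φ y + μ - g y ≤ 0 := by
      refine nonpos_of_hasDerivWithinAt_Iio ((hφd.add hlin).sub hGd).hasDerivWithinAt ?_
      filter_upwards [self_mem_nhdsWithin, nhdsWithin_le_nhds hmax] with x hx hmx
      have hG : ∫ z in y..x, g z ≤ 0 := by
        rw [intervalIntegral.integral_symm, neg_nonpos]
        exact intervalIntegral.integral_nonneg (Set.mem_Iio.1 hx).le fun z _ => hg0 z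
      have h3 := h₁ x y
      rw [abs_of_nonpos hG] at h3
      have h4 := (abs_le.1 h3).1
      simp only [Pi.add_apply, Pi.sub_apply, intervalIntegral.integral_same]
      have h5 : w x - φ x ≤ w y - φ y := hmx
      linarith
    have h6 : |μ + deriv φ y| ≤ |g y| :=
      (abs_le.2 ⟨by linarith, by linarith⟩ : |μ + deriv φ y| ≤ g y).trans (le_abs_self _)
    have h7 := eikonal_le_eikonal (r := γ) h6
    rw [hgE] at h7
    linarith
  · have hφd : HasDerivAt φ (deriv φ y) y :=
      ((hφ.differentiable one_ne_zero) y).hasDerivAt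
    have hev : ∀ᶠ x in 𝓝 y, w y - φ y ≤ w x - φ x := hmin
    -- At a minimum of `w - φ`, either one-sided derivative in `h₂` gives `|μ + φ'| ≥ g`; nothing is
    -- needed where `g = 0`.
    have h6 : |g y| ≤ |μ + deriv φ y| := by
      rcases h₂ y with h | h | h
      · rw [h, abs_zero]; exact abs_nonneg _
      · have := nonpos_of_hasDerivWithinAt_Iio (h.sub hφd.hasDerivWithinAt)
          (nhdsWithin_le_nhds hev)
        rw [abs_of_nonneg (hg0 y)]
        exact le_trans (by linarith) (le_abs_self _)
      · have := nonneg_of_hasDerivWithinAt_Ioi (h.sub hφd.hasDerivWithinAt)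
          (nhdsWithin_le_nhds hev)
        rw [abs_of_nonneg (hg0 y)]
        exact le_trans (by linarith) (neg_le_abs _)
    have h7 := eikonal_le_eikonal (r := γ) h6
    rw [hgE] at h7
    linarith

theorem hasDerivWithinAt_primitive_Iio {q p : ℝ → ℝ} {a c y : ℝ}
    (hq : ∀ a b, IntervalIntegrable q MeasureTheory.volume a b) (hp : Continuous p) (ha : a < y)
    (h : ∀ z ∈ Set.Ioo a y, q z = p z) :
    HasDerivWithinAt (fun x => ∫ z in c..x, q z) (p y) (Set.Iio y) y := by
  have h1 : HasDerivAt (fun x => (∫ z in c..y, q z) + ∫ z in y..x, p z) (p y) y :=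
    (hp.integral_hasStrictDerivAt y y).hasDerivAt.const_add _
  refine h1.hasDerivWithinAt.congr_of_eventuallyEq ?_ (by simp)
  filter_upwards [Ioo_mem_nhdsLT ha] with x hx
  rw [← intervalIntegral.integral_add_adjacent_intervals (hq c y) (hq y x),
    intervalIntegral.integral_symm x y, intervalIntegral.integral_symm x y,
    intervalIntegral.integral_of_le hx.2.le, intervalIntegral.integral_of_le hx.2.le,
    MeasureTheory.integral_Ioc_eq_integral_Ioo, MeasureTheory.integral_Ioc_eq_integral_Ioo,
    MeasureTheory.setIntegral_congr_fun measurableSet_Ioo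
      fun z hz => h z ⟨hx.1.trans hz.1, hz.2⟩]

theorem hasDerivWithinAt_primitive_Ioi {q p : ℝ → ℝ} {b c y : ℝ}
    (hq : ∀ a b, IntervalIntegrable q MeasureTheory.volume a b) (hp : Continuous p) (hb : y < b)
    (h : ∀ z ∈ Set.Ioo y b, q z = p z) :
    HasDerivWithinAt (fun x => ∫ z in c..x, q z) (p y) (Set.Ioi y) y := by
  have h1 : HasDerivAt (fun x => (∫ z in c..y, q z) + ∫ z in y..x, p z) (p y) y :=
    (hp.integral_hasStrictDerivAt y y).hasDerivAt.const_add _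
  refine h1.hasDerivWithinAt.congr_of_eventuallyEq ?_ (by simp)
  filter_upwards [Ioo_mem_nhdsGT hb] with x hx
  rw [← intervalIntegral.integral_add_adjacent_intervals (hq c y) (hq y x),
    intervalIntegral.integral_of_le hx.1.le, intervalIntegral.integral_of_le hx.1.le,
    MeasureTheory.integral_Ioc_eq_integral_Ioo, MeasureTheory.integral_Ioc_eq_integral_Ioo,
    MeasureTheory.setIntegral_congr_fun measurableSet_Ioo
      fun z hz => h z ⟨hz.1, hz.2.trans hx.2⟩]

/-- The primitive of `σ g - μ` is a periodic viscosity solution of the eikonal equation if `σ` is a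
periodic sign, `σ g` has mean `μ`, and `σ` changes only from `+` to `-` where `g ≠ 0`. -/
theorem isViscositySolution_primitive {γ μ H c : ℝ} {f g σ : ℝ → ℝ} (hg : Continuous g)
    (hgp : Function.Periodic g 1) (hg0 : ∀ y, 0 ≤ g y) (hgE : ∀ y, eikonal γ (g y) = H - f y)
    (hσm : Measurable σ) (hσp : Function.Periodic σ 1) (hσ : ∀ y, |σ y| = 1)
    (hμ : ∫ y in c..(c + 1), σ y * g y = μ)
    (hsw : ∀ y, g y = 0 ∨ (∃ a < y, ∀ z ∈ Set.Ioo a y, σ z = 1) ∨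
      ∃ b > y, ∀ z ∈ Set.Ioo y b, σ z = -1) :
    Function.Periodic (fun y => ∫ z in c..y, (σ z * g z - μ)) 1 ∧
    IsViscositySolution (fun y q => eikonal γ (μ + q) + f y - H)
      (fun y => ∫ z in c..y, (σ z * g z - μ)) := by
  have hi1 : ∀ a b, IntervalIntegrable (fun z => σ z * g z) MeasureTheory.volume a b := by
    intro a b
    refine (hg.intervalIntegrable a b).mono_fun
      (hσm.mul hg.measurable).aestronglyMeasurable ?_
    refine Eventually.of_forall fun z => ?_
    simp [hσ z]
  have hi : ∀ a b, IntervalIntegrable (fun z => σ z * g z - μ) MeasureTheory.volume a b :=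
    fun a b => (hi1 a b).sub (by simp)
  have hqp : Function.Periodic (fun z => σ z * g z - μ) 1 := fun z => by simp [hσp z, hgp z]
  have hmean : ∫ z in (0 : ℝ)..1, (σ z * g z - μ) = 0 := by
    have h1 := hqp.intervalIntegral_add_eq 0 c
    rw [zero_add] at h1
    rw [h1, intervalIntegral.integral_sub (hi1 _ _) (by simp), hμ]
    simp
  refine ⟨hqp.periodic_primitive hi hmean c, isViscositySolution_of_abs_sub_le hg hg0 hgE
    (intervalIntegral.continuous_primitive hi c) (fun x y => ?_) fun y => ?_⟩
  · have h1 : ((∫ z in c..x, (σ z * g z - μ)) + μ * x) - ((∫ z in c..y, (σ z * g z - μ)) + μ * y)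
        = ∫ z in y..x, σ z * g z := by
      rw [← intervalIntegral.integral_add_adjacent_intervals (hi c y) (hi y x),
        intervalIntegral.integral_sub (hi1 y x) (by simp)]
      simp
      ring
    rw [h1]
    have h2 := intervalIntegral.norm_integral_le_abs_integral_norm (f := fun z => σ z * g z)
      (a := y) (b := x) (μ := MeasureTheory.volume)
    simpa [abs_mul, hσ, abs_of_nonneg (hg0 _)] using h2
  · rcases hsw y with h | ⟨a, ha, h⟩ | ⟨b, hb, h⟩
    · exact Or.inl h
    · exact Or.inr (Or.inl (hasDerivWithinAt_primitive_Iio (p := fun z => g z - μ) hi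
        (hg.sub continuous_const) ha fun z hz => by rw [h z hz, one_mul]))
    · exact Or.inr (Or.inr (hasDerivWithinAt_primitive_Ioi (p := fun z => -g z - μ) hi
        (hg.neg.sub continuous_const) hb fun z hz => by rw [h z hz, neg_one_mul]))

/-- The equation demands `|μ + w'| = g H` with `g H = √((H - f)² - γ²)`, and `H₀ = |γ| + max f` is
the least admissible speed. If `|μ|` exceeds the mean of `g H₀`, the speed is raised until the mean
of `g H` is `|μ|`, and a constant sign works. Otherwise `H₀` is kept and the sign switches from `+`
to `-` at a point `y₁` that adjusts the mean; the switch back, inadmissible where `g > 0`, is placed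
at the maximum `y₀` of `f`, where `g H₀ = 0`. -/
theorem exists_inviscid_solution {f : ℝ → ℝ} (hf : Continuous f) (hfp : Function.Periodic f 1)
    (γ μ : ℝ) : ∃ H w, Function.Periodic w 1 ∧
      IsViscositySolution (fun y q => eikonal γ (μ + q) + f y - H) w := by
  obtain ⟨y₀, hy₀⟩ := hfp.exists_isMaxOn hf
  set H₀ := |γ| + f y₀ with hH₀
  set g : ℝ → ℝ → ℝ := fun H y => √((H - f y) ^ 2 - γ ^ 2) with hgdef
  have hgc2 : Continuous fun z : ℝ × ℝ => g z.1 z.2 := by simp only [hgdef]; fun_prop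
  have hgc : ∀ H, Continuous (g H) := fun H => by simp only [hgdef]; fun_prop
  have hgp : ∀ H, Function.Periodic (g H) 1 := fun H y => by simp [hgdef, hfp y]
  have hg0 : ∀ H y, 0 ≤ g H y := fun H y => Real.sqrt_nonneg _
  have hge : ∀ H, H₀ ≤ H → ∀ y, |γ| ≤ H - f y := fun H hH y => by linarith [hy₀ y]
  have hgE : ∀ H, H₀ ≤ H → ∀ y, eikonal γ (g H y) = H - f y := fun H hH y => by
    have h1 := hge H hH y
    have h2 : γ ^ 2 ≤ (H - f y) ^ 2 := sq_le_sq.2 (h1.trans (le_abs_self _))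
    rw [eikonal, Real.sq_sqrt (by linarith), add_sub_cancel,
      Real.sqrt_sq ((abs_nonneg _).trans h1)]
  have hmc : Continuous fun H => ∫ y in (0 : ℝ)..1, g H y :=
    intervalIntegral.continuous_parametric_intervalIntegral_of_continuous' hgc2 0 1
  have hshift : ∀ H c, ∫ y in c..(c + 1), g H y = ∫ y in (0 : ℝ)..1, g H y := fun H c => by
    have := (hgp H).intervalIntegral_add_eq c 0
    rwa [zero_add] at this
  rcases lt_or_ge (∫ y in (0 : ℝ)..1, g H₀ y) |μ| with hlt | hge'
  · have hbig : |μ| ≤ ∫ y in (0 : ℝ)..1, g (H₀ + |μ|) y := by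
      have hle : ∀ y, |μ| ≤ g (H₀ + |μ|) y := fun y => by
        refine Real.le_sqrt_of_sq_le ?_
        have h1 := hge H₀ le_rfl y
        have h2 := abs_nonneg μ
        have h3 := abs_nonneg γ
        rw [← sq_abs γ]
        nlinarith
      have := intervalIntegral.integral_mono_on (μ := MeasureTheory.volume)
        (f := fun _ => |μ|) (zero_le_one (α := ℝ)) (by simp)
        ((hgc (H₀ + |μ|)).intervalIntegrable 0 1) fun y _ => hle y
      simpa using this
    obtain ⟨H, hH, hHμ⟩ := intermediate_value_Icc (a := H₀) (b := H₀ + |μ|)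
      (by linarith [abs_nonneg μ]) hmc.continuousOn ⟨hlt.le, hbig⟩
    simp only at hHμ
    rcases le_total 0 μ with hμ | hμ
    · rw [abs_of_nonneg hμ] at hHμ
      exact ⟨H, _, isViscositySolution_primitive (c := 0) (σ := fun _ => 1) (hgc H) (hgp H) (hg0 H)
        (hgE H hH.1) measurable_const (fun _ => rfl) (by simp) (by simp [hHμ])
        (fun y => Or.inr (Or.inl ⟨y - 1, by linarith, fun _ _ => rfl⟩))⟩
    · rw [abs_of_nonpos hμ] at hHμ
      exact ⟨H, _, isViscositySolution_primitive (c := 0) (σ := fun _ => -1) (hgc H) (hgp H) (hg0 H)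
        (hgE H hH.1) measurable_const (fun _ => rfl) (by simp) (by simp [hHμ])
        (fun y => Or.inr (Or.inr ⟨y + 1, by linarith, fun _ _ => rfl⟩))⟩
  · have hi : ∀ a b, IntervalIntegrable (g H₀) MeasureTheory.volume a b :=
      fun a b => (hgc H₀).intervalIntegrable a b
    have hcont : Continuous fun y => (∫ x in y₀..y, g H₀ x) - ∫ x in y..(y₀ + 1), g H₀ x := by
      have h1 := intervalIntegral.continuous_primitive hi y₀
      have h2 := (intervalIntegral.continuous_primitive hi (y₀ + 1)).neg
      refine h1.sub (h2.congr fun y => ?_)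
      rw [intervalIntegral.integral_symm]
      rfl
    -- As the switching point crosses one period, the signed integral runs from minus to plus the
    -- mean of `g H₀`.
    obtain ⟨y₁, hy₁, hμ⟩ := intermediate_value_Icc (a := y₀) (b := y₀ + 1) (by linarith)
      hcont.continuousOn (show μ ∈ _ by
        simp only [intervalIntegral.integral_same, hshift]
        exact ⟨by linarith [neg_abs_le μ], by linarith [le_abs_self μ]⟩)
    simp only at hμ
    set σ : ℝ → ℝ := fun y => if Int.fract (y - y₀) < y₁ - y₀ then 1 else -1 with hσ
    have hσ1 : ∀ {y}, y ∈ Set.Ico y₀ y₁ → σ y = 1 := fun {y} hy => by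
      have : Int.fract (y - y₀) = y - y₀ :=
        Int.fract_eq_self.2 ⟨by linarith [hy.1], by linarith [hy.2, hy₁.2]⟩
      simp only [hσ, this]
      rw [if_pos (by linarith [hy.2])]
    have hσ2 : ∀ {y}, y ∈ Set.Ico y₁ (y₀ + 1) → σ y = -1 := fun {y} hy => by
      have : Int.fract (y - y₀) = y - y₀ :=
        Int.fract_eq_self.2 ⟨by linarith [hy.1, hy₁.1], by linarith [hy.2]⟩
      simp only [hσ, this]
      rw [if_neg (by linarith [hy.1])]
    have hσm : Measurable σ := by
      refine Measurable.ite (measurableSet_lt ?_ measurable_const) measurable_const measurable_const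
      exact measurable_fract.comp (measurable_id.sub measurable_const)
    have hσp : Function.Periodic σ 1 := fun y => by
      simp only [hσ]
      rw [show y + 1 - y₀ = y - y₀ + 1 by ring, Int.fract_add_one]
    have hσa : ∀ y, |σ y| = 1 := fun y => by
      simp only [hσ]; split_ifs <;> simp
    have hiσ : ∀ a b, IntervalIntegrable (fun z => σ z * g H₀ z) MeasureTheory.volume a b := by
      intro a b
      refine (hi a b).mono_fun (hσm.mul (hgc H₀).measurable).aestronglyMeasurable ?_
      exact Eventually.of_forall fun z => by simp [hσa z]
    refine ⟨H₀, _, isViscositySolution_primitive (c := y₀) (σ := σ) (hgc H₀) (hgp H₀) (hg0 H₀)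
        (hgE H₀ le_rfl) hσm hσp hσa ?_ fun y => ?_⟩
    · rw [← hμ, ← intervalIntegral.integral_add_adjacent_intervals (hiσ y₀ y₁) (hiσ y₁ (y₀ + 1)),
        intervalIntegral.integral_of_le hy₁.1, intervalIntegral.integral_of_le hy₁.2,
        intervalIntegral.integral_of_le hy₁.1, intervalIntegral.integral_of_le hy₁.2]
      simp only [MeasureTheory.integral_Ioc_eq_integral_Ioo]
      rw [sub_eq_add_neg, ← MeasureTheory.integral_neg]
      congr 1
      · exact MeasureTheory.setIntegral_congr_fun measurableSet_Ioo fun z hz => by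
          simp only [hσ1 ⟨hz.1.le, hz.2⟩, one_mul]
      · exact MeasureTheory.setIntegral_congr_fun measurableSet_Ioo fun z hz => by
          simp only [hσ2 ⟨hz.1.le, hz.2⟩, neg_one_mul]
    · set θ := Int.fract (y - y₀) with hθ
      have hyθ : ∀ z, σ z = σ (z - ⌊y - y₀⌋) := fun z => by
        have := hσp.sub_int_mul_eq (x := z) ⌊y - y₀⌋
        rw [mul_one] at this
        exact this.symm
      have hfl : y - ⌊y - y₀⌋ = y₀ + θ := by
        have := Int.self_sub_floor (y - y₀)
        rw [← hθ] at this
        linarith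
      rcases (Int.fract_nonneg (y - y₀)).eq_or_lt with h | h
      · left
        have h1 := (hgp H₀).sub_int_mul_eq (x := y) ⌊y - y₀⌋
        rw [mul_one, hfl, hθ, ← h, add_zero] at h1
        rw [← h1]
        simp [hgdef, hH₀]
      · right
        rcases le_or_gt θ (y₁ - y₀) with h' | h'
        · left
          refine ⟨y - θ, by linarith, fun z hz => ?_⟩
          rw [hyθ]
          exact hσ1 ⟨by linarith [hz.1], by linarith [hz.2]⟩
        · right
          have hθ1 := Int.fract_lt_one (y - y₀)
          refine ⟨y + (1 - θ), by linarith, fun z hz => ?_⟩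
          rw [hyθ]
          exact hσ2 ⟨by linarith [hz.1], by linarith [hz.2]⟩

/-! ### Comparison by doubling of variables -/

/-- A positive second derivative would make the point a local minimum as well, so `g` would be
locally constant. -/
theorem deriv_deriv_nonpos_of_isLocalMax {g : ℝ → ℝ} {x : ℝ} (hc : Continuous g)
    (h : IsLocalMax g x) : deriv (deriv g) x ≤ 0 := by
  by_contra! hpos
  have hmin := isLocalMin_of_deriv_deriv_pos hpos h.deriv_eq_zero hc.continuousAt
  have heq : g =ᶠ[𝓝 x] fun _ => g x := by
    filter_upwards [h, hmin] with z h1 h2 using le_antisymm h1 h2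
  have := heq.deriv.deriv_eq
  simp only [deriv_const', deriv_const] at this
  exact hpos.ne' this

theorem hasDerivAt_quadratic (a ε z : ℝ) :
    HasDerivAt (fun z => (z - a) ^ 2 / (2 * ε)) ((z - a) / ε) z := by
  have h := ((((hasDerivAt_id z).sub_const a).pow 2).div_const (2 * ε))
  refine h.congr_deriv ?_
  simp only [id, Nat.cast_ofNat, Nat.add_one_sub_one, pow_one, mul_one]
  exact mul_div_mul_left _ _ two_ne_zero

/-- First and second order conditions where a paraboloid touches a `C²` function from above. -/
theorem ContDiff.deriv_of_touches {W : ℝ → ℝ} (hW : ContDiff ℝ 2 W) {a x ε : ℝ}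
    (hmax : ∀ z, W z - (z - a) ^ 2 / (2 * ε) ≤ W x - (x - a) ^ 2 / (2 * ε)) :
    deriv W x = (x - a) / ε ∧ deriv (deriv W) x ≤ 1 / ε := by
  have hWd : ∀ z, HasDerivAt W (deriv W z) z := fun z =>
    ((hW.differentiable two_ne_zero) z).hasDerivAt
  have hW' : ∀ z, HasDerivAt (deriv W) (deriv (deriv W) z) z := fun z =>
    (((contDiff_succ_iff_deriv (n := 1)).1 hW).2.2.differentiable one_ne_zero z).hasDerivAt
  have hd : ∀ z, HasDerivAt (fun z => W z - (z - a) ^ 2 / (2 * ε)) (deriv W z - (z - a) / ε) z :=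
    fun z => (hWd z).sub (hasDerivAt_quadratic a ε z)
  have hloc : IsLocalMax (fun z => W z - (z - a) ^ 2 / (2 * ε)) x := Eventually.of_forall hmax
  have h1 := hloc.hasDerivAt_eq_zero (hd x)
  have h2 := deriv_deriv_nonpos_of_isLocalMax
    (continuous_iff_continuousAt.2 fun z => (hd z).continuousAt) hloc
  have h3 : deriv (fun z => W z - (z - a) ^ 2 / (2 * ε)) = fun z => deriv W z - (z - a) / ε :=
    funext fun z => (hd z).deriv
  have h4 : HasDerivAt (fun z => deriv W z - (z - a) / ε) (deriv (deriv W) x - 1 / ε) x :=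
    (hW' x).sub (((hasDerivAt_id x).sub_const a).div_const ε)
  rw [h3, h4.deriv] at h2
  exact ⟨by linarith, by linarith⟩

/-- The doubled functional `w₁ x - w₂ y - (x - y)² / (2 ε)` attains its maximum. -/
theorem exists_doubling_max {w₁ w₂ : ℝ → ℝ} {ε : ℝ} (hε : 0 < ε) (hc₁ : Continuous w₁)
    (hc₂ : Continuous w₂) (hp₁ : Function.Periodic w₁ 1) (hp₂ : Function.Periodic w₂ 1) :
    ∃ x y, ∀ x' y', w₁ x' - w₂ y' - (x' - y') ^ 2 / (2 * ε) ≤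
      w₁ x - w₂ y - (x - y) ^ 2 / (2 * ε) := by
  obtain ⟨M, hM0, hM⟩ := hp₂.exists_abs_le hc₂
  set R := 1 + 4 * ε * M with hR
  have hR1 : 1 ≤ R := le_add_of_nonneg_right (by positivity)
  -- In the variables `x` and `s = x - y` the functional is periodic in `x`, and for `|s| ≥ R` the
  -- penalty is at least `2 M`, so `s = 0` does no worse. A maximum over a compact box is thus
  -- global.
  set Φ : ℝ × ℝ → ℝ := fun z => w₁ z.1 - w₂ (z.1 - z.2) - z.2 ^ 2 / (2 * ε) with hΦ
  have hΦc : Continuous Φ := by simp only [hΦ]; fun_prop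
  obtain ⟨⟨x, s⟩, -, hmax⟩ := (isCompact_Icc.prod isCompact_Icc :
    IsCompact (Set.Icc (0 : ℝ) 1 ×ˢ Set.Icc (-R) R)).exists_isMaxOn
      ⟨(0, 0), ⟨le_rfl, zero_le_one⟩, by linarith, by linarith⟩ hΦc.continuousOn
  have hbox : ∀ x' s', s' ∈ Set.Icc (-R) R → Φ (x', s') ≤ Φ (x, s) := fun x' s' hs' => by
    have hper : Function.Periodic (fun x' => Φ (x', s')) 1 := fun z => by
      simp only [hΦ]
      rw [hp₁ z, show z + 1 - s' = z - s' + 1 by ring, hp₂]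
    obtain ⟨z, hz, hzx⟩ := hper.exists_mem_Ico₀ one_pos x'
    rw [hzx]
    exact hmax ⟨⟨hz.1, hz.2.le⟩, hs'⟩
  have hall : ∀ x' s', Φ (x', s') ≤ Φ (x, s) := fun x' s' => by
    by_cases hs' : s' ∈ Set.Icc (-R) R
    · exact hbox x' s' hs'
    · refine le_trans ?_ (hbox x' 0 ⟨by linarith, by linarith⟩)
      have h1 : R ≤ |s'| := by
        by_contra! hcon
        exact hs' (abs_le.1 hcon.le)
      have h2 : 4 * ε * M ≤ s' ^ 2 := by
        rw [← sq_abs]; nlinarith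
      have h3 : 2 * M ≤ s' ^ 2 / (2 * ε) := by
        rw [le_div_iff₀ (by positivity)]; linarith
      simp only [hΦ, sub_zero]
      have h4 := (abs_le.1 (hM (x' - s'))).1
      have h5 := (abs_le.1 (hM x')).2
      norm_num
      linarith
  refine ⟨x, x - s, fun x' y' => ?_⟩
  have := hall x' (x' - y')
  simpa [hΦ] using this

/-- Comparison of the speeds of an approximate subsolution and an approximate supersolution, both
tested with paraboloids only. -/
theorem speed_sub_speed_le {γ μ H₁ H₂ δ₁ δ₂ ε L M : ℝ} {f w₁ w₂ : ℝ → ℝ} (hε : 0 < ε) (hL0 : 0 ≤ L)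
    (hL : ∀ x y, |f x - f y| ≤ L * |x - y|) (hc₁ : Continuous w₁) (hc₂ : Continuous w₂)
    (hp₁ : Function.Periodic w₁ 1) (hp₂ : Function.Periodic w₂ 1)
    (h₁ : ∀ x y, (∀ z, w₁ z - (z - y) ^ 2 / (2 * ε) ≤ w₁ x - (x - y) ^ 2 / (2 * ε)) →
      eikonal γ (μ + (x - y) / ε) + f x ≤ H₁ + δ₁)
    (h₂ : ∀ x y, (∀ z, w₂ y + (y - x) ^ 2 / (2 * ε) ≤ w₂ z + (z - x) ^ 2 / (2 * ε)) →
      H₂ - δ₂ ≤ eikonal γ (μ + (x - y) / ε) + f y)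
    (hM : (∀ x, |w₁ x| ≤ M) ∨ ∀ x, |w₂ x| ≤ M) :
    H₂ - H₁ ≤ δ₁ + δ₂ + L * √(4 * ε * M) := by
  obtain ⟨x, y, hxy⟩ := exists_doubling_max hε hc₁ hc₂ hp₁ hp₂
  have a1 := h₁ x y fun z => by linarith [hxy z y]
  have a2 := h₂ x y fun z => by
    have := hxy x z
    rw [show (y - x) ^ 2 = (x - y) ^ 2 by ring, show (z - x) ^ 2 = (x - z) ^ 2 by ring]
    linarith
  -- Comparison with `(y, y)` or `(x, x)` cancels one of the functions, so a bound for the other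
  -- suffices.
  have a3 : (x - y) ^ 2 / (2 * ε) ≤ 2 * M := by
    rcases hM with h | h
    · have h3 := hxy y y
      rw [sub_self, zero_pow two_ne_zero, zero_div] at h3
      linarith [(abs_le.1 (h x)).2, (abs_le.1 (h y)).1]
    · have h3 := hxy x x
      rw [sub_self, zero_pow two_ne_zero, zero_div] at h3
      linarith [(abs_le.1 (h x)).2, (abs_le.1 (h y)).1]
  rw [div_le_iff₀ (by positivity)] at a3
  have a4 : |x - y| ≤ √(4 * ε * M) := Real.abs_le_sqrt (by linarith)
  have a5 := (abs_le.1 ((hL x y).trans (mul_le_mul_of_nonneg_left a4 hL0))).1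
  linarith

theorem IsViscositySubsolution.paraboloid {γ μ H ε : ℝ} {f w : ℝ → ℝ}
    (h : IsViscositySubsolution (fun y q => eikonal γ (μ + q) + f y - H) w) {x y : ℝ}
    (hxy : ∀ z, w z - (z - y) ^ 2 / (2 * ε) ≤ w x - (x - y) ^ 2 / (2 * ε)) :
    eikonal γ (μ + (x - y) / ε) + f x ≤ H := by
  have := h.2 (fun z => (z - y) ^ 2 / (2 * ε)) (by fun_prop) x (Eventually.of_forall hxy)
  rw [(hasDerivAt_quadratic y ε x).deriv] at this
  linarith

theorem IsViscositySupersolution.paraboloid {γ μ H ε : ℝ} {f w : ℝ → ℝ}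
    (h : IsViscositySupersolution (fun y q => eikonal γ (μ + q) + f y - H) w) {x y : ℝ}
    (hxy : ∀ z, w y + (y - x) ^ 2 / (2 * ε) ≤ w z + (z - x) ^ 2 / (2 * ε)) :
    H ≤ eikonal γ (μ + (x - y) / ε) + f y := by
  have := h.2 (fun z => -((z - x) ^ 2 / (2 * ε))) (by fun_prop) y
    (Eventually.of_forall fun z => by
      have := hxy z
      simp only
      linarith)
  rw [(hasDerivAt_quadratic x ε y).fun_neg.deriv, show -((y - x) / ε) = (x - y) / ε by ring] at this
  linarith

/-- The coefficient `γ² / (γ² + a²)` lies in `[0, 1]`, also for `γ = a = 0`, where the quotient is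
`0` by convention. -/
theorem curvature_mul_le {d γ a b ε : ℝ} (hd : 0 < d) (hε : 0 < ε) (hb : b ≤ 1 / ε) :
    d * γ ^ 2 * b / (γ ^ 2 + a ^ 2) ≤ d / ε := by
  have h1 : γ ^ 2 / (γ ^ 2 + a ^ 2) ≤ 1 := div_le_one_of_le₀ (by nlinarith) (by positivity)
  have h2 : 0 ≤ γ ^ 2 / (γ ^ 2 + a ^ 2) := by positivity
  have h3 : γ ^ 2 / (γ ^ 2 + a ^ 2) * b ≤ 1 / ε := by
    have : 0 < 1 / ε := by positivity
    nlinarith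
  calc d * γ ^ 2 * b / (γ ^ 2 + a ^ 2) = d * (γ ^ 2 / (γ ^ 2 + a ^ 2) * b) := by ring
    _ ≤ d * (1 / ε) := mul_le_mul_of_nonneg_left h3 hd.le
    _ = d / ε := by ring

theorem IsCellSolution.paraboloid_above {v w : ℝ → ℝ} {d γ μ H ε : ℝ}
    (h : IsCellSolution v d γ μ H w) (hd : 0 < d) (hε : 0 < ε) {x y : ℝ}
    (hxy : ∀ z, w z - (z - y) ^ 2 / (2 * ε) ≤ w x - (x - y) ^ 2 / (2 * ε)) :
    eikonal γ (μ + (x - y) / ε) + γ * v x ≤ H + d / ε := by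
  obtain ⟨h1, h2⟩ := h.contDiff.deriv_of_touches hxy
  have h3 := h.equation x
  have h4 := curvature_mul_le (γ := γ) (a := μ + deriv w x) hd hε h2
  rw [h1] at h3 h4
  rw [eikonal]
  linarith

theorem IsCellSolution.paraboloid_below {v w : ℝ → ℝ} {d γ μ H ε : ℝ}
    (h : IsCellSolution v d γ μ H w) (hd : 0 < d) (hε : 0 < ε) {x y : ℝ}
    (hxy : ∀ z, w y + (y - x) ^ 2 / (2 * ε) ≤ w z + (z - x) ^ 2 / (2 * ε)) :
    H - d / ε ≤ eikonal γ (μ + (x - y) / ε) + γ * v y := by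
  obtain ⟨h1, h2⟩ := h.contDiff.neg.deriv_of_touches (a := x) (x := y) (ε := ε)
    (fun z => by linarith [hxy z])
  have hneg : deriv (fun z => -w z) = fun z => -deriv w z := funext fun z => deriv.fun_neg
  rw [hneg] at h1 h2
  rw [deriv.fun_neg] at h2
  have h1' : deriv w y = (x - y) / ε := by
    have : (y - x) / ε = -((x - y) / ε) := by ring
    rw [this] at h1
    simpa using h1
  have h3 := h.equation y
  have h4 := curvature_mul_le (γ := γ) (a := μ + deriv w y) hd hε h2
  rw [mul_neg, neg_div] at h4
  rw [h1'] at h3 h4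
  rw [eikonal]
  linarith

/-- The doubling estimate with no curvature error, as `ε → 0`; exchanging the roles gives uniqueness
of the speed. -/
theorem inviscid_speed_le {γ μ H₁ H₂ L : ℝ} {f w₁ w₂ : ℝ → ℝ} (hL0 : 0 ≤ L)
    (hL : ∀ x y, |f x - f y| ≤ L * |x - y|) (hp₁ : Function.Periodic w₁ 1)
    (hp₂ : Function.Periodic w₂ 1)
    (h₁ : IsViscositySolution (fun y q => eikonal γ (μ + q) + f y - H₁) w₁)
    (h₂ : IsViscositySolution (fun y q => eikonal γ (μ + q) + f y - H₂) w₂) : H₂ ≤ H₁ := by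
  obtain ⟨M, hM0, hM⟩ := hp₁.exists_abs_le h₁.1.1
  have hcont : Continuous fun ε : ℝ => L * √(4 * ε * M) := by fun_prop
  have hlim : Tendsto (fun ε : ℝ => L * √(4 * ε * M)) (𝓝[>] 0) (𝓝 0) := by
    simpa using (hcont.tendsto 0).mono_left nhdsWithin_le_nhds
  have := ge_of_tendsto hlim (b := H₂ - H₁) (by
    filter_upwards [self_mem_nhdsWithin] with ε hε
    have := speed_sub_speed_le (γ := γ) (μ := μ) (H₁ := H₁) (H₂ := H₂) (δ₁ := 0) (δ₂ := 0) hε hL0 hL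
      h₁.1.1 h₂.1.1 hp₁ hp₂ (fun x y hxy => by simpa using h₁.1.paraboloid hxy)
      (fun x y hxy => by simpa using h₂.2.paraboloid hxy) (Or.inl hM)
    simpa using this)
  linarith

/-- The speed of a viscous cell problem is close to that of the inviscid one. -/
theorem IsCellSolution.abs_speed_sub_inviscid_le {v w w₀ : ℝ → ℝ} {d γ μ H H₀ L M : ℝ} (hL0 : 0 ≤ L)
    (hL : ∀ x y, |γ * v x - γ * v y| ≤ L * |x - y|) (h : IsCellSolution v d γ μ H w) (hd : 0 < d)
    (h₀ : IsInviscidCellSolution v γ μ H₀ w₀) (hM : ∀ x, |w₀ x| ≤ M) :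
    |H - H₀| ≤ √d + L * √(4 * √d * M) := by
  -- With `ε = √d` the curvature error `d / ε` and the doubling error both vanish as `d → 0`; `M`
  -- bounds the inviscid solution and so does not involve `d`.
  have hε : 0 < √d := Real.sqrt_pos.2 hd
  have hdiv : d / √d = √d := Real.div_sqrt
  have h₀' : IsViscositySolution (fun y q => eikonal γ (μ + q) + γ * v y - H₀) w₀ := h₀.2
  have b1 := speed_sub_speed_le (γ := γ) (μ := μ) (H₁ := H) (H₂ := H₀) (δ₁ := d / √d) (δ₂ := 0)
    (f := fun y => γ * v y) hε hL0 hL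
    h.contDiff.continuous h₀'.1.1 h.periodic h₀.1 (fun x y hxy => h.paraboloid_above hd hε hxy)
    (fun x y hxy => by simpa using h₀'.2.paraboloid hxy) (Or.inr hM)
  have b2 := speed_sub_speed_le (γ := γ) (μ := μ) (H₁ := H₀) (H₂ := H) (δ₁ := 0) (δ₂ := d / √d)
    (f := fun y => γ * v y) hε hL0 hL
    h₀'.1.1 h.contDiff.continuous h₀.1 h.periodic (fun x y hxy => by simpa using h₀'.1.paraboloid hxy)
    (fun x y hxy => h.paraboloid_below hd hε hxy) (Or.inl hM)
  rw [hdiv] at b1 b2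
  exact abs_le.2 ⟨by linarith, by linarith⟩

theorem exists_lipschitz_of_contDiff_periodic {v : ℝ → ℝ} (hv : ContDiff ℝ 1 v)
    (hp : Function.Periodic v 1) : ∃ L, 0 ≤ L ∧ ∀ x y, |v x - v y| ≤ L * |x - y| := by
  have hp' : Function.Periodic (deriv v) 1 := fun y => by
    rw [← deriv_comp_add_const, funext hp]
  obtain ⟨L, hL0, hL⟩ := hp'.exists_abs_le (hv.continuous_deriv le_rfl)
  refine ⟨L, hL0, fun x y => ?_⟩
  exact convex_univ.norm_image_sub_le_of_norm_deriv_le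
    (fun z _ => hv.differentiable one_ne_zero z) (fun z _ => hL z) (Set.mem_univ y) (Set.mem_univ x)

/-! ### The limit of large Markstein numbers -/

/-- The constant in the rate of convergence as the Markstein number tends to infinity. -/
noncomputable def flatRate (r μ M : ℝ) : ℝ :=
  (r ^ 2 + (eikonal r μ + 2 * M) ^ 2) / r ^ 2 * residualBound r μ M

/-- The a priori bounds make the derivative of `u` of order `1 / d`, and `u` attains its mean within
distance `1` of every point up to periodicity. -/
theorem IsSlope.abs_sub_mean_le {f u : ℝ → ℝ} {d r H M μ : ℝ} (h : IsSlope f d r H u) (hd : 0 < d)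
    (hr : 0 < r) (hM : ∀ y, |f y| ≤ M) (hμ : ∫ y in (0 : ℝ)..1, u y = μ) (y : ℝ) :
    |u y - μ| ≤ flatRate r μ M / d := by
  have hM0 : 0 ≤ M := (abs_nonneg _).trans (hM 0)
  have hQ0 : 0 ≤ residualBound r μ M := residualBound_nonneg hM0
  have hbd : ∀ y, |slopeField d r H (f y) (u y)| ≤ flatRate r μ M / d := fun y => by
    rw [slopeField_eq, abs_mul, abs_div _ d, abs_of_pos hd, abs_of_nonneg (by positivity), flatRate,
      mul_div_assoc]
    have h1 := sq_le_sq.2 ((h.abs_slope_le hd hr hM hμ y).trans (le_abs_self _))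
    exact mul_le_mul (div_le_div_of_nonneg_right (by linarith) (by positivity))
      (div_le_div_of_nonneg_right (h.abs_residual_le hd hr hM hμ y) hd.le) (by positivity)
      (by positivity)
  obtain ⟨z, hz⟩ := exists_eq_of_integral_eq h.continuous (continuous_const (y := μ)) (by simp [hμ])
  obtain ⟨x, hx, hxy⟩ := h.periodic.exists_mem_Ico one_pos y z
  have := convex_univ.norm_image_sub_le_of_norm_hasDerivWithin_le
    (fun x (_ : x ∈ Set.univ) => (h.hasDerivAt x).hasDerivWithinAt) (fun x _ => hbd x)
    (Set.mem_univ z) (Set.mem_univ x)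
  rw [Real.norm_eq_abs, Real.norm_eq_abs, sub_eq_zero.1 hz, ← hxy] at this
  have h0 : 0 ≤ flatRate r μ M / d := (abs_nonneg _).trans (hbd 0)
  have h1 : |x - z| ≤ 1 := abs_le.2 ⟨by linarith [hx.1], by linarith [hx.2]⟩
  nlinarith

/-- Integral of the divergence form over one period. -/
theorem IsSlope.speed_eq {f u : ℝ → ℝ} {d r H : ℝ} (h : IsSlope f d r H u) (hd : 0 < d)
    (hr : 0 < r) (hf : Continuous f) :
    H = (∫ y in (0 : ℝ)..1, eikonal r (u y)) + ∫ y in (0 : ℝ)..1, f y := by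
  have hEc : Continuous fun y => eikonal r (u y) := (continuous_eikonal r).comp h.continuous
  have h1 := intervalIntegral.integral_eq_sub_of_hasDerivAt (a := 0) (b := 1)
    (fun y _ => h.hasDerivAt_curvAngle hr y)
    (((hEc.add hf).sub continuous_const).div_const d |>.intervalIntegrable _ _)
  have h01 : u 1 = u 0 := by simpa using h.periodic 0
  rw [h01, sub_self, intervalIntegral.integral_div, div_eq_zero_iff,
    intervalIntegral.integral_sub ((hEc.fun_add hf).intervalIntegrable _ _) (by simp),
    intervalIntegral.integral_add (hEc.intervalIntegrable _ _) (hf.intervalIntegrable _ _)] at h1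
  have h2 := h1.resolve_right hd.ne'
  simp only [intervalIntegral.integral_const, sub_zero, one_smul] at h2
  linarith

theorem IsSlope.abs_speed_sub_flat_le {f u : ℝ → ℝ} {d r H M μ : ℝ} (h : IsSlope f d r H u)
    (hd : 0 < d) (hr : 0 < r) (hf : Continuous f) (hM : ∀ y, |f y| ≤ M)
    (hμ : ∫ y in (0 : ℝ)..1, u y = μ) :
    |H - (eikonal r μ + ∫ y in (0 : ℝ)..1, f y)| ≤ flatRate r μ M / d := by
  have hEc : Continuous fun y => eikonal r (u y) := (continuous_eikonal r).comp h.continuous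
  have e : H - (eikonal r μ + ∫ y in (0 : ℝ)..1, f y)
      = ∫ y in (0 : ℝ)..1, (eikonal r (u y) - eikonal r μ) := by
    rw [intervalIntegral.integral_sub (hEc.intervalIntegrable _ _) (by simp), h.speed_eq hd hr hf]
    simp
  rw [e]
  exact abs_integral_le_of_abs_le fun y _ =>
    (abs_eikonal_sub_le r _ _).trans (h.abs_sub_mean_le hd hr hM hμ y)

/-! ### Cell problem and slope equation -/

theorem eikonal_abs (γ t : ℝ) : eikonal |γ| t = eikonal γ t := by
  rw [eikonal, eikonal, sq_abs]

theorem IsCellSolution.hasDerivAt {v w : ℝ → ℝ} {d γ μ H : ℝ} (h : IsCellSolution v d γ μ H w)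
    (y : ℝ) : HasDerivAt w (deriv w y) y :=
  ((h.contDiff.differentiable two_ne_zero) y).hasDerivAt

theorem IsCellSolution.hasDerivAt_deriv {v w : ℝ → ℝ} {d γ μ H : ℝ}
    (h : IsCellSolution v d γ μ H w) (y : ℝ) : HasDerivAt (deriv w) (deriv (deriv w) y) y :=
  (((contDiff_succ_iff_deriv (n := 1)).1 h.contDiff).2.2.differentiable one_ne_zero y).hasDerivAt

theorem IsCellSolution.continuous_deriv {v w : ℝ → ℝ} {d γ μ H : ℝ}
    (h : IsCellSolution v d γ μ H w) : Continuous (deriv w) :=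
  h.contDiff.continuous_deriv one_le_two

theorem IsCellSolution.integral_slope {v w : ℝ → ℝ} {d γ μ H : ℝ}
    (h : IsCellSolution v d γ μ H w) : ∫ y in (0 : ℝ)..1, (μ + deriv w y) = μ := by
  have hi := h.continuous_deriv.intervalIntegrable (μ := MeasureTheory.volume) 0 1
  rw [intervalIntegral.integral_add (by simp) hi,
    intervalIntegral.integral_eq_sub_of_hasDerivAt (fun y _ => h.hasDerivAt y) hi]
  have : w 1 = w 0 := by simpa using h.periodic 0
  simp [this]

theorem IsCellSolution.isSlope {v w : ℝ → ℝ} {d γ μ H : ℝ} (h : IsCellSolution v d γ μ H w)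
    (hd : 0 < d) (hγ : γ ≠ 0) :
    IsSlope (fun y => γ * v y) d |γ| H (fun y => μ + deriv w y) := by
  refine ⟨fun y => ?_, fun y => ?_⟩
  · have : deriv w (y + 1) = deriv w y := by rw [← deriv_comp_add_const, funext h.periodic]
    simp [this]
  · refine ((h.hasDerivAt_deriv y).const_add μ).congr_deriv ?_
    have h1 := h.equation y
    have h2 : 0 < γ ^ 2 := by positivity
    rw [slopeField, eikonal_abs, sq_abs, eikonal, ← h1]
    field_simp
    ring

theorem IsSlope.isCellSolution {v u : ℝ → ℝ} {d γ μ H : ℝ}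
    (h : IsSlope (fun y => γ * v y) d |γ| H u) (hd : 0 < d) (hγ : γ ≠ 0) (hv : Continuous v)
    (hμ : ∫ y in (0 : ℝ)..1, u y = μ) :
    IsCellSolution v d γ μ H (fun y => ∫ x in (0 : ℝ)..y, (u x - μ)) := by
  have huc := h.continuous
  have hqc : Continuous fun x => u x - μ := huc.sub continuous_const
  have hw : ∀ y, HasDerivAt (fun y => ∫ x in (0 : ℝ)..y, (u x - μ)) (u y - μ) y := fun y =>
    (hqc.integral_hasStrictDerivAt 0 y).hasDerivAt
  have hw' : deriv (fun y => ∫ x in (0 : ℝ)..y, (u x - μ)) = fun y => u y - μ :=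
    funext fun y => (hw y).deriv
  have hu' : ∀ y, HasDerivAt (fun y => u y - μ) (slopeField d |γ| H (γ * v y) (u y)) y :=
    fun y => (h.hasDerivAt y).sub_const μ
  have hw'' : deriv (fun y => u y - μ) = fun y => slopeField d |γ| H (γ * v y) (u y) :=
    funext fun y => (hu' y).deriv
  have hEc : Continuous fun y => eikonal |γ| (u y) := (continuous_eikonal _).comp huc
  refine ⟨?_, ?_, fun y => ?_⟩
  · refine (contDiff_succ_iff_deriv (n := 1)).2 ⟨fun y => (hw y).differentiableAt, by simp, ?_⟩
    rw [hw', contDiff_one_iff_deriv]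
    refine ⟨fun y => (hu' y).differentiableAt, ?_⟩
    rw [hw'']
    unfold slopeField
    fun_prop
  · refine Function.Periodic.periodic_primitive (fun y => by simp [h.periodic y])
      (fun a b => hqc.intervalIntegrable a b) ?_ 0
    rw [intervalIntegral.integral_sub (huc.intervalIntegrable _ _) (by simp), hμ]
    simp
  · rw [hw', hw'']
    have h2 : 0 < γ ^ 2 := by positivity
    simp only [add_sub_cancel, slopeField, eikonal_abs, sq_abs]
    rw [eikonal]
    field_simp
    ring

theorem isCellSolution_zero (v : ℝ → ℝ) (d μ : ℝ) : IsCellSolution v d 0 μ |μ| fun _ => 0 := by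
  refine ⟨contDiff_const, fun _ => rfl, fun y => ?_⟩
  simp [Real.sqrt_sq_eq_abs]

/-- Here `|μ + w'| = H`, and `w'` vanishes somewhere because its mean is zero, so `H = |μ|`. For `μ
≠ 0`, differentiating `(μ + w')² = μ²` gives `w'' = 0`. -/
theorem IsCellSolution.eq_of_zero {v w : ℝ → ℝ} {d μ H : ℝ} (h : IsCellSolution v d 0 μ H w) :
    H = |μ| ∧ deriv w = fun _ => 0 := by
  have heq : ∀ y, |μ + deriv w y| = H := fun y => by
    have := h.equation y
    simpa [Real.sqrt_sq_eq_abs] using this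
  have hmean : ∫ y in (0 : ℝ)..1, deriv w y = 0 := by
    have := h.integral_slope
    rw [intervalIntegral.integral_add (by simp) (h.continuous_deriv.intervalIntegrable _ _)] at this
    simpa using this
  obtain ⟨z, hz⟩ := exists_eq_zero_of_integral_eq_zero h.continuous_deriv hmean
  have hH : H = |μ| := by rw [← heq z, hz, add_zero]
  refine ⟨hH, funext fun y => ?_⟩
  rcases eq_or_ne μ 0 with hμ | hμ
  · have := heq y
    simpa [hH, hμ] using this
  · have hsq : ∀ y, (μ + deriv w y) ^ 2 = μ ^ 2 := fun y => by
      rw [← sq_abs, heq y, hH, sq_abs]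
    have hzero : ∀ y, deriv (deriv w) y = 0 := fun y => by
      have h1 := ((h.hasDerivAt_deriv y).const_add μ).pow 2
      have h2 : HasDerivAt ((fun y => μ + deriv w y) ^ 2) 0 y := by
        rw [show (fun y => μ + deriv w y) ^ 2 = fun _ => μ ^ 2 from funext hsq]
        exact hasDerivAt_const _ _
      have h3 := h1.unique h2
      have h4 : μ + deriv w y ≠ 0 := fun h0 => by
        have := hsq y
        rw [h0] at this
        exact hμ (by simpa using this.symm)
      simpa [h4] using h3
    rw [is_const_of_deriv_eq_zero (fun y => (h.hasDerivAt_deriv y).differentiableAt) hzero y z, hz]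

theorem IsCellSolution.unique {v w w' : ℝ → ℝ} {d γ μ H H' : ℝ} (hd : 0 < d) (hv : Continuous v)
    (hp : Function.Periodic v 1) (h : IsCellSolution v d γ μ H w)
    (h' : IsCellSolution v d γ μ H' w') : H = H' ∧ deriv w = deriv w' := by
  rcases eq_or_ne γ 0 with rfl | hγ
  · rw [h.eq_of_zero.1, h'.eq_of_zero.1, h.eq_of_zero.2, h'.eq_of_zero.2]
    exact ⟨rfl, rfl⟩
  · obtain ⟨h1, h2⟩ := (h.isSlope hd hγ).unique (h'.isSlope hd hγ) hd (abs_pos.2 hγ)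
      (continuous_const.mul hv) (fun y => by simp [hp y])
      (h.integral_slope.trans h'.integral_slope.symm)
    exact ⟨h1, funext fun y => add_left_cancel (congrFun h2 y)⟩

theorem IsCellSolution.eq_of_apply_zero {v w w' : ℝ → ℝ} {d γ μ H H' : ℝ} (hd : 0 < d)
    (hv : Continuous v) (hp : Function.Periodic v 1) (h : IsCellSolution v d γ μ H w)
    (h' : IsCellSolution v d γ μ H' w') (h0 : w 0 = w' 0) : w = w' := by
  have hder := (h.unique hd hv hp h').2
  have hd0 : ∀ y, HasDerivAt (fun y => w y - w' y) 0 y := fun y => by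
    have := (h.hasDerivAt y).sub (h'.hasDerivAt y)
    rwa [hder, sub_self] at this
  funext y
  have := is_const_of_deriv_eq_zero (fun y => (hd0 y).differentiableAt) (fun y => (hd0 y).deriv) y 0
  simp only [h0, sub_self] at this
  exact sub_eq_zero.1 this

theorem exists_isCellSolution {v : ℝ → ℝ} (hv : Continuous v) (hp : Function.Periodic v 1)
    {d : ℝ} (hd : 0 < d) (γ μ : ℝ) : ∃ H w, IsCellSolution v d γ μ H w ∧ w 0 = 0 := by
  rcases eq_or_ne γ 0 with rfl | hγ
  · exact ⟨|μ|, _, isCellSolution_zero v d μ, rfl⟩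
  · obtain ⟨H, u, hu, hμ⟩ := exists_isSlope hd (abs_pos.2 hγ) (continuous_const.mul hv)
      (f := fun y => γ * v y) (fun y => by simp [hp y]) μ
    exact ⟨H, _, hu.isCellSolution hd hγ hv hμ, by simp⟩

theorem isCellSolution_cellCorrector {v : ℝ → ℝ} (hv : Continuous v) (hp : Function.Periodic v 1)
    {d : ℝ} (hd : 0 < d) (γ μ : ℝ) :
    IsCellSolution v d γ μ (effectiveSpeed v d γ μ) (cellCorrector v d γ μ) ∧
      cellCorrector v d γ μ 0 = 0 := by
  obtain ⟨H, w, hw, hw0⟩ := exists_isCellSolution hv hp hd γ μ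
  obtain ⟨w', hw'⟩ := Classical.epsilon_spec
    (p := fun H : ℝ => ∃ w : ℝ → ℝ, IsCellSolution v d γ μ H w) ⟨H, w, hw⟩
  -- Uniqueness identifies the speed of the normalized solution with the one selected by
  -- `Classical.epsilon`.
  have hH : H = effectiveSpeed v d γ μ := (hw.unique hd hv hp hw').1
  exact Classical.epsilon_spec (p := fun w : ℝ → ℝ =>
    IsCellSolution v d γ μ (effectiveSpeed v d γ μ) w ∧ w 0 = 0) ⟨w, hH ▸ hw, hw0⟩

theorem effectiveSpeed_zero {v : ℝ → ℝ} (hv : Continuous v) (hp : Function.Periodic v 1)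
    {d : ℝ} (hd : 0 < d) (μ : ℝ) : effectiveSpeed v d 0 μ = |μ| :=
  (isCellSolution_cellCorrector hv hp hd 0 μ).1.eq_of_zero.1

theorem cellCorrector_zero {v : ℝ → ℝ} (hv : Continuous v) (hp : Function.Periodic v 1)
    {d : ℝ} (hd : 0 < d) (μ : ℝ) : cellCorrector v d 0 μ = fun _ => 0 :=
  have h := isCellSolution_cellCorrector hv hp hd 0 μ
  h.1.eq_of_apply_zero hd hv hp (isCellSolution_zero v d μ) h.2

theorem abs_cellCorrector_le {v : ℝ → ℝ} (hv : Continuous v) (hp : Function.Periodic v 1)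
    {d γ M : ℝ} (hd : 0 < d) (hγ : γ ≠ 0) (hM : ∀ y, |γ * v y| ≤ M) (μ y : ℝ) :
    |cellCorrector v d γ μ y| ≤ flatRate |γ| μ M / d := by
  obtain ⟨h, h0⟩ := isCellSolution_cellCorrector hv hp hd γ μ
  have hbd : ∀ y, |deriv (cellCorrector v d γ μ) y| ≤ flatRate |γ| μ M / d := fun y => by
    have := (h.isSlope hd hγ).abs_sub_mean_le hd (abs_pos.2 hγ) hM h.integral_slope y
    rwa [add_sub_cancel_left] at this
  obtain ⟨x, hx, hxy⟩ := h.periodic.exists_mem_Ico₀ one_pos y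
  have := convex_univ.norm_image_sub_le_of_norm_hasDerivWithin_le
    (fun x (_ : x ∈ Set.univ) => (h.hasDerivAt x).hasDerivWithinAt) (fun x _ => hbd x)
    (Set.mem_univ 0) (Set.mem_univ x)
  rw [h0, sub_zero, sub_zero, Real.norm_eq_abs, Real.norm_eq_abs, ← hxy, abs_of_nonneg hx.1] at this
  have h1 : 0 ≤ flatRate |γ| μ M / d := (abs_nonneg _).trans (hbd 0)
  nlinarith [hx.2]

theorem tendsto_effectiveSpeed_atTop {v : ℝ → ℝ} (hv : Continuous v) (hp : Function.Periodic v 1)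
    (γ μ : ℝ) : Tendsto (fun d : ℝ => effectiveSpeed v d γ μ) atTop
      (𝓝 (√(γ ^ 2 + μ ^ 2) + γ * ∫ y in (0 : ℝ)..1, v y)) := by
  rcases eq_or_ne γ 0 with rfl | hγ
  · refine tendsto_const_nhds.congr' ?_
    filter_upwards [eventually_gt_atTop 0] with d hd
    rw [effectiveSpeed_zero hv hp hd]
    simp [Real.sqrt_sq_eq_abs]
  · have hf : Continuous fun y => γ * v y := continuous_const.mul hv
    obtain ⟨M, -, hM⟩ := Function.Periodic.exists_abs_le (u := fun y => γ * v y)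
      (fun y => by simp [hp y]) hf
    refine tendsto_iff_dist_tendsto_zero.2 (squeeze_zero' (Eventually.of_forall
      fun _ => dist_nonneg) (g := fun d => flatRate |γ| μ M / d) ?_
      (tendsto_const_nhds.div_atTop tendsto_id))
    filter_upwards [eventually_gt_atTop 0] with d hd
    have h := (isCellSolution_cellCorrector hv hp hd γ μ).1
    have := (h.isSlope hd hγ).abs_speed_sub_flat_le hd (abs_pos.2 hγ) hf hM h.integral_slope
    rwa [eikonal_abs, intervalIntegral.integral_const_mul] at this

theorem tendstoUniformly_cellCorrector {v : ℝ → ℝ} (hv : Continuous v)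
    (hp : Function.Periodic v 1) (γ μ : ℝ) :
    TendstoUniformly (fun d : ℝ => cellCorrector v d γ μ) (fun _ : ℝ => 0) atTop := by
  rw [Metric.tendstoUniformly_iff]
  intro ε hε
  rcases eq_or_ne γ 0 with rfl | hγ
  · filter_upwards [eventually_gt_atTop 0] with d hd y
    rw [cellCorrector_zero hv hp hd, dist_self]
    exact hε
  · obtain ⟨M, -, hM⟩ := Function.Periodic.exists_abs_le (u := fun y => γ * v y)
      (fun y => by simp [hp y]) (continuous_const.mul hv)
    have hlim : Tendsto (fun d : ℝ => flatRate |γ| μ M / d) atTop (𝓝 0) :=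
      tendsto_const_nhds.div_atTop tendsto_id
    filter_upwards [eventually_gt_atTop 0, hlim.eventually (gt_mem_nhds hε)] with d hd hlt y
    rw [dist_comm, Real.dist_eq, sub_zero]
    exact (abs_cellCorrector_le hv hp hd hγ hM μ y).trans_lt hlt

theorem exists_hasDerivAt_effectiveSpeed_neg {v : ℝ → ℝ} (hv : Continuous v)
    (hp : Function.Periodic v 1) (hnc : ¬ ∃ c : ℝ, ∀ y : ℝ, v y = c) {γ : ℝ} (hγ : γ ≠ 0) (μ : ℝ)
    {d : ℝ} (hd : 0 < d) :
    ∃ c < 0, HasDerivAt (fun s : ℝ => effectiveSpeed v s γ μ) c d := by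
  refine exists_hasDerivAt_speed_neg (f := fun y => γ * v y) (r := |γ|) (μ := μ) (abs_pos.2 hγ)
    (continuous_const.mul hv) (fun y => by simp [hp y]) ?_
    (us := fun d y => μ + deriv (cellCorrector v d γ μ) y)
    (fun d hd => (isCellSolution_cellCorrector hv hp hd γ μ).1.isSlope hd hγ)
    (fun d hd => (isCellSolution_cellCorrector hv hp hd γ μ).1.integral_slope) hd
  rintro ⟨c, hc⟩
  exact hnc ⟨c / γ, fun y => by rw [← hc y]; field_simp⟩

theorem existsUnique_inviscid_speed {v : ℝ → ℝ} (hv : ContDiff ℝ 1 v) (hp : Function.Periodic v 1)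
    (γ μ : ℝ) : ∃! H : ℝ, ∃ w : ℝ → ℝ, IsInviscidCellSolution v γ μ H w := by
  obtain ⟨H, w, hwp, hw⟩ := exists_inviscid_solution (continuous_const.mul hv.continuous)
    (f := fun y => γ * v y) (fun y => by simp [hp y]) γ μ
  obtain ⟨L, hL0, hL⟩ := exists_lipschitz_of_contDiff_periodic (v := fun y => γ * v y)
    (contDiff_const.mul hv) (fun y => by simp [hp y])
  refine ⟨H, ⟨w, hwp, hw⟩, ?_⟩
  rintro H' ⟨w', hwp', hw'⟩
  exact le_antisymm (inviscid_speed_le hL0 hL hwp hwp' hw hw')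
    (inviscid_speed_le hL0 hL hwp' hwp hw' hw)

theorem tendsto_effectiveSpeed_inviscid {v : ℝ → ℝ} (hv : ContDiff ℝ 1 v)
    (hp : Function.Periodic v 1) (γ μ : ℝ) :
    Tendsto (fun d : ℝ => effectiveSpeed v d γ μ) (𝓝[>] 0) (𝓝 (inviscidEffectiveSpeed v γ μ)) := by
  obtain ⟨w₀, h₀⟩ : ∃ w, IsInviscidCellSolution v γ μ (inviscidEffectiveSpeed v γ μ) w :=
    Classical.epsilon_spec (p := fun H : ℝ => ∃ w : ℝ → ℝ, IsInviscidCellSolution v γ μ H w)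
      (existsUnique_inviscid_speed hv hp γ μ).exists
  obtain ⟨L, hL0, hL⟩ := exists_lipschitz_of_contDiff_periodic (v := fun y => γ * v y)
    (contDiff_const.mul hv) (fun y => by simp [hp y])
  obtain ⟨M, -, hM⟩ := h₀.1.exists_abs_le h₀.2.1.1
  refine tendsto_iff_dist_tendsto_zero.2 (squeeze_zero' (Eventually.of_forall
    fun _ => dist_nonneg) (g := fun d => √d + L * √(4 * √d * M)) ?_ ?_)
  · filter_upwards [self_mem_nhdsWithin] with d hd
    exact (isCellSolution_cellCorrector hv.continuous hp hd γ μ).1.abs_speed_sub_inviscid_le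
      hL0 hL hd h₀ hM
  · have : Continuous fun d : ℝ => √d + L * √(4 * √d * M) := by fun_prop
    simpa using (this.tendsto 0).mono_left nhdsWithin_le_nhds

theorem theorem1p1 (v : ℝ → ℝ) (hv : ContDiff ℝ ∞ v) (hper : Function.Periodic v 1)
    (hnc : ¬ ∃ c : ℝ, ∀ y : ℝ, v y = c) :
    -- well-posedness: `H̄_d(p)`, `w` and `H̄_0(p)` exist and are unique
    (∀ d γ μ : ℝ, 0 < d →
      (∃! H : ℝ, ∃ w : ℝ → ℝ, IsCellSolution v d γ μ H w) ∧
      (∃! w : ℝ → ℝ, IsCellSolution v d γ μ (effectiveSpeed v d γ μ) w ∧ w 0 = 0)) ∧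
    (∀ γ μ : ℝ, ∃! H : ℝ, ∃ w : ℝ → ℝ, IsInviscidCellSolution v γ μ H w) ∧
    -- (1)
    (∀ d μ : ℝ, 0 < d →
      effectiveSpeed v d 0 μ = |μ| ∧ effectiveSpeed v d 0 (-μ) = |μ|) ∧
    -- (2)
    (∀ γ μ : ℝ, γ ≠ 0 →
      (∀ d : ℝ, 0 < d →
        DifferentiableAt ℝ (fun s : ℝ => effectiveSpeed v s γ μ) d ∧
        deriv (fun s : ℝ => effectiveSpeed v s γ μ) d < 0) ∧
      StrictAntiOn (fun s : ℝ => effectiveSpeed v s γ μ) (Set.Ioi 0)) ∧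
    -- (3)
    (∀ γ μ : ℝ, Tendsto (fun d : ℝ => effectiveSpeed v d γ μ) (𝓝[>] 0)
      (𝓝 (inviscidEffectiveSpeed v γ μ))) ∧
    -- (4)
    (∀ γ μ : ℝ,
      Tendsto (fun d : ℝ => effectiveSpeed v d γ μ) atTop
        (𝓝 (√(γ ^ 2 + μ ^ 2) + γ * ∫ y in (0 : ℝ)..1, v y)) ∧
      TendstoUniformly (fun d : ℝ => cellCorrector v d γ μ) (fun _ : ℝ => 0) atTop) := by
  have hc : Continuous v := hv.continuous
  have hv1 : ContDiff ℝ 1 v := hv.of_le (by exact_mod_cast le_top)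
  refine ⟨fun d γ μ hd => ?_, existsUnique_inviscid_speed hv1 hper, fun d μ hd => ?_,
    fun γ μ hγ => ⟨fun d hd => ?_, ?_⟩, tendsto_effectiveSpeed_inviscid hv1 hper,
    fun γ μ => ⟨tendsto_effectiveSpeed_atTop hc hper γ μ,
      tendstoUniformly_cellCorrector hc hper γ μ⟩⟩
  · have h := isCellSolution_cellCorrector hc hper hd γ μ
    refine ⟨⟨_, ⟨_, h.1⟩, ?_⟩, ⟨_, h, ?_⟩⟩
    · rintro H ⟨w, hw⟩
      exact (hw.unique hd hc hper h.1).1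
    · rintro w ⟨hw, hw0⟩
      exact hw.eq_of_apply_zero hd hc hper h.1 (hw0.trans h.2.symm)
  · rw [effectiveSpeed_zero hc hper hd, effectiveSpeed_zero hc hper hd, abs_neg]
    exact ⟨rfl, rfl⟩
  · obtain ⟨c, hc0, hder⟩ := exists_hasDerivAt_effectiveSpeed_neg hc hper hnc hγ μ hd
    exact ⟨hder.differentiableAt, by rwa [hder.deriv]⟩
  · refine strictAntiOn_of_deriv_neg (convex_Ioi 0) (fun d hd => ?_) fun d hd => ?_
    · obtain ⟨c, -, hder⟩ := exists_hasDerivAt_effectiveSpeed_neg hc hper hnc hγ μ hd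
      exact hder.continuousAt.continuousWithinAt
    · rw [interior_Ioi] at hd
      obtain ⟨c, hc0, hder⟩ := exists_hasDerivAt_effectiveSpeed_neg hc hper hnc hγ μ hd
      rwa [hder.deriv]
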